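/- Let $\Bbbk$ be a field in which every element has a square root, and let $\Gamma=(V,E)$ be a finite simple graph. A collection of skew-zigzag coefficients is a family $v=(v^a_{b,c}\in\Bbbk)$, indexed by the triples with $\{a,b\},\{a,c\}\in E$, such that $v^a_{b,b}=1$, $v^a_{b,c}v^a_{c,b}=1$ and $v^a_{b,c}v^a_{c,d}v^a_{d,b}=1$ for all neighbours $b,c,d$ of $a$. Let $D\Gamma$ be the double quiver of $\Gamma$, with arrows $(a|b)$ and $(b|a)$ for each edge $\{a,b\}$, and let $\Bbbk D\Gamma$ be its path algebra, graded by path length. The skew-zigzag algebra $A_v(\Gamma)$ is the quotient of $\Bbbk D\Gamma$ by the two-sided ideal generated by all paths $(a|b|c)$ with $a\neq c$ and all elements $(a|b|a)-v^a_{b,c}(a|c|a)$, with the induced grading; if $|V|=2$ it is instead the quotient of $\Bbbk D\Gamma$ by the two-sided ideal generated by all paths of length greater than two, and if $|V|=1$ it is $\Bbbk[X]/(X^2)$, with $X$ in degree $2$. Let $\Sigma/_{\cong}$ be the set of skew-zigzag algebras of $\Gamma$ up to arbitrary isomorphism of graded $\Bbbk$-algebras (not required to fix the vertices). Let $E'$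 be the set of arrows of $D\Gamma$, let $\mathcal C$ be the kernel of $\mathbb ZE'/\langle (a|b)+(b|a)\rangle\to\mathbb ZV$, $(a|b)\mapsto a-b$, and put $H^1(\Gamma,\Bbbk^*)=\operatorname{Hom}(\mathcal C,\Bbbk^*)$. The group $\operatorname{Aut}(\Gamma)$ of graph automorphisms acts on it by $(\sigma f)(C)=f(\sigma^{-1}(C))$. For a collection $v$ of skew-zigzag coefficients let $f_v\in H^1(\Gamma,\Bbbk^*)$ be the homomorphism whose value on the class of each closed path $(a_1|a_2|\cdots|a_n)$, $a_n=a_1$, $n\ge 2$, is $v^{a_1}_{a_{n-1},a_2}\prod_{i=2}^{n-1}v^{a_i}_{a_{i-1},a_{i+1}}$. Then there is a bijection $$\Sigma/_{\cong}\;\cong\;H^1(\Gamma,\Bbbk^*)/\operatorname{Aut}(\Gamma),$$ which sends the isomorphism class of $A_v(\Gamma)$ to the $\operatorname{Aut}(\Gamma)$-orbit of $f_v$, for every collection $v$ of skew-zigzag coefficients. -/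

import Mathlib

universe u w

noncomputable section

namespace SkewZigzag

/-! ### The path algebra of a quiver -/

/-- A path in the quiver `Q`, together with its source and its target.
The paths of length zero are the trivial paths `(a)`. -/
structure TotalPath (Q : Type u) [Quiver.{0} Q] : Type u where
  /-- the source -/
  src : Q
  /-- the target -/
  tgt : Q
  /-- the path from the source to the target -/
  path : Quiver.Path src tgt

/-- The underlying vector space of the path algebra: its basis consists of all the paths. -/
def PathAlgebra (k : Type w) [Field k] (Q : Type u) [Quiver.{0} Q] : Type (max u w) :=
  TotalPath Q →₀ k

namespace PathAlgebra

variable (k : Type w) [Field k] {Q : Type u} [Quiver.{0} Q]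

instance : AddCommGroup (PathAlgebra k Q) := inferInstanceAs (AddCommGroup (TotalPath Q →₀ k))

instance : Module k (PathAlgebra k Q) := inferInstanceAs (Module k (TotalPath Q →₀ k))

/-- The basis vector of the path algebra given by a path. -/
def of {a b : Q} (p : Quiver.Path a b) : PathAlgebra k Q :=
  Finsupp.single (⟨a, b, p⟩ : TotalPath Q) (1 : k)

open Classical in
/-- The product of two paths: their concatenation (first `p`, then `q`) if the target of `p` is
the source of `q`, and zero otherwise. -/
def concat (p q : TotalPath Q) : PathAlgebra k Q :=
  if h : p.tgt = q.src then of k ((p.path.cast rfl h).comp q.path) else 0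

/-- The bilinear extension of the concatenation of paths. -/
def mulMap : PathAlgebra k Q →ₗ[k] PathAlgebra k Q →ₗ[k] PathAlgebra k Q :=
  Finsupp.linearCombination k (M := PathAlgebra k Q →ₗ[k] PathAlgebra k Q)
    fun p => Finsupp.linearCombination k (M := PathAlgebra k Q) fun q => concat k p q

instance : Mul (PathAlgebra k Q) := ⟨fun x y => mulMap k x y⟩

instance [Fintype Q] : One (PathAlgebra k Q) := ⟨∑ a : Q, of k (Quiver.Path.nil : Quiver.Path a a)⟩

variable {k}

theorem mul_def (x y : PathAlgebra k Q) : x * y = mulMap k x y := rfl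

theorem one_def [Fintype Q] :
    (1 : PathAlgebra k Q) = ∑ a : Q, of k (Quiver.Path.nil : Quiver.Path a a) := rfl

theorem lhom_ext {M : Type*} [AddCommMonoid M] [Module k M] {f g : PathAlgebra k Q →ₗ[k] M}
    (h : ∀ (a b : Q) (p : Quiver.Path a b), f (of k p) = g (of k p)) : f = g :=
  Finsupp.lhom_ext' fun p => LinearMap.ext_ring (h p.src p.tgt p.path)

theorem of_mul_of {a b c d : Q} (p : Quiver.Path a b) (q : Quiver.Path c d) :
    of k p * of k q = concat k ⟨a, b, p⟩ ⟨c, d, q⟩ := by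
  rw [mul_def, mulMap, of, of]
  erw [Finsupp.linearCombination_single, one_smul, Finsupp.linearCombination_single, one_smul]

/-- Composable paths multiply by concatenation. -/
theorem of_mul_of_comp {a b c : Q} (p : Quiver.Path a b) (q : Quiver.Path b c) :
    of k p * of k q = of k (p.comp q) := by
  rw [of_mul_of, concat, dif_pos rfl]
  rfl

/-- Paths that cannot be composed have product zero. -/
theorem of_mul_of_ne {a b c d : Q} (p : Quiver.Path a b) (q : Quiver.Path c d) (h : b ≠ c) :
    of k p * of k q = 0 := by
  rw [of_mul_of, concat, dif_neg h]

theorem add_mul' (x y z : PathAlgebra k Q) : (x + y) * z = x * z + y * z := by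
  simp [mul_def]

theorem mul_add' (x y z : PathAlgebra k Q) : x * (y + z) = x * y + x * z := by
  simp [mul_def]

theorem zero_mul' (x : PathAlgebra k Q) : 0 * x = 0 := by
  simp [mul_def]

theorem mul_zero' (x : PathAlgebra k Q) : x * 0 = 0 := by
  simp [mul_def]

theorem of_mul_assoc {a b c d e f : Q} (p : Quiver.Path a b) (q : Quiver.Path c d)
    (r : Quiver.Path e f) : of k p * of k q * of k r = of k p * (of k q * of k r) := by
  by_cases h : b = c
  · subst h
    by_cases h' : d = e
    · subst h'
      simp only [of_mul_of_comp, Quiver.Path.comp_assoc]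
    · rw [of_mul_of_comp, of_mul_of_ne _ _ h', of_mul_of_ne _ _ h', mul_zero']
  · rw [of_mul_of_ne _ _ h, zero_mul']
    by_cases h' : d = e
    · subst h'
      rw [of_mul_of_comp, of_mul_of_ne _ _ h]
    · rw [of_mul_of_ne _ _ h', mul_zero']

theorem mul_assoc' (x y z : PathAlgebra k Q) : x * y * z = x * (y * z) := by
  let L : PathAlgebra k Q →ₗ[k] PathAlgebra k Q →ₗ[k] PathAlgebra k Q →ₗ[k] PathAlgebra k Q :=
    (mulMap k).compr₂ (mulMap k)
  let R : PathAlgebra k Q →ₗ[k] PathAlgebra k Q →ₗ[k] PathAlgebra k Q →ₗ[k] PathAlgebra k Q :=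
    ((LinearMap.llcomp k (PathAlgebra k Q) (PathAlgebra k Q) (PathAlgebra k Q)).comp
      (mulMap k)).compl₂ (mulMap k)
  have h : L = R :=
    lhom_ext fun a b p => lhom_ext fun c d q => lhom_ext fun e f r => of_mul_assoc p q r
  exact congrArg (fun F => F x y z) h

theorem one_mul_of [Fintype Q] {a b : Q} (p : Quiver.Path a b) :
    1 * of k p = of k p := by
  rw [one_def, mul_def, map_sum, LinearMap.sum_apply, Finset.sum_eq_single a]
  · rw [← mul_def, of_mul_of_comp, Quiver.Path.nil_comp]
  · intro c _ hc
    rw [← mul_def, of_mul_of_ne _ _ hc]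
  · intro h
    exact absurd (Finset.mem_univ a) h

theorem of_mul_one [Fintype Q] {a b : Q} (p : Quiver.Path a b) :
    of k p * 1 = of k p := by
  rw [one_def, mul_def, map_sum, Finset.sum_eq_single b]
  · rw [← mul_def, of_mul_of_comp, Quiver.Path.comp_nil]
  · intro c _ hc
    rw [← mul_def, of_mul_of_ne _ _ hc.symm]
  · intro h
    exact absurd (Finset.mem_univ b) h

theorem one_mul' [Fintype Q] (x : PathAlgebra k Q) : 1 * x = x := by
  have h : mulMap k (1 : PathAlgebra k Q) = LinearMap.id :=
    lhom_ext fun a b p => one_mul_of p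
  exact congrArg (fun F => F x) h

theorem mul_one' [Fintype Q] (x : PathAlgebra k Q) : x * 1 = x := by
  have h : (mulMap k).flip (1 : PathAlgebra k Q) = LinearMap.id :=
    lhom_ext fun a b p => of_mul_one p
  exact congrArg (fun F => F x) h

instance [Fintype Q] : Ring (PathAlgebra k Q) :=
  { (inferInstance : AddCommGroup (PathAlgebra k Q)) with
    mul := (· * ·)
    one := 1
    left_distrib := mul_add'
    right_distrib := add_mul'
    zero_mul := zero_mul'
    mul_zero := mul_zero'
    mul_assoc := mul_assoc'
    one_mul := one_mul'
    mul_one := mul_one' }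

instance [Fintype Q] : Algebra k (PathAlgebra k Q) :=
  Algebra.ofModule (fun r x y => by simp [mul_def]) (fun r x y => by simp [mul_def])

variable (k Q)

/-- The homogeneous component of degree `i`: the span of the paths of length `i`. -/
def piece (i : ℕ) : Submodule k (PathAlgebra k Q) :=
  Submodule.span k {x | ∃ (a b : Q) (p : Quiver.Path a b), p.length = i ∧ x = of k p}

end PathAlgebra

/-! ### Double graphs and skew-zigzag algebras -/

/-- The vertex set of the double graph of `Γ`. -/
def DoubleGraph {V : Type u} (_Γ : SimpleGraph V) : Type u := V

/-- The double graph of `Γ` as a quiver: each edge `{a, b}` of `Γ` gives one arrow from `a` to `b`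
and one arrow from `b` to `a`. -/
instance {V : Type u} (Γ : SimpleGraph V) : Quiver.{0} (DoubleGraph Γ) :=
  ⟨fun a b => PLift (Γ.Adj a b)⟩

instance {V : Type u} (Γ : SimpleGraph V) [Fintype V] : Fintype (DoubleGraph Γ) :=
  inferInstanceAs (Fintype V)

/-- The path `(a | b)` of length one in the double graph. -/
def path₁ {V : Type u} {Γ : SimpleGraph V} {a b : V} (h : Γ.Adj a b) :
    Quiver.Path (V := DoubleGraph Γ) a b :=
  Quiver.Hom.toPath (V := DoubleGraph Γ) (PLift.up h)

/-- The path `(a | b | c)` of length two in the double graph. -/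
def path₂ {V : Type u} {Γ : SimpleGraph V} {a b c : V} (h : Γ.Adj a b) (h' : Γ.Adj b c) :
    Quiver.Path (V := DoubleGraph Γ) a c :=
  (path₁ h).comp (path₁ h')

/-- Collections of skew-zigzag coefficients `v^a_{b,c}` for `Γ`, where `b` and `c` run over
the neighbours of `a`. -/
structure Coefficients (k : Type w) [Field k] {V : Type u} (Γ : SimpleGraph V) where
  /-- `coeff a b c` is `v^a_{b,c}` -/
  coeff : (a : V) → Γ.neighborSet a → Γ.neighborSet a → k
  coeff_self : ∀ a b, coeff a b b = 1
  coeff_mul_symm : ∀ a b c, coeff a b c * coeff a c b = 1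
  coeff_cycle : ∀ a b c d, coeff a b c * coeff a c d * coeff a d b = 1

/-- A `k`-algebra together with a family of subspaces indexed by degree (for the algebras below,
these subspaces are the homogeneous components of the grading). -/
structure GradedAlg (k : Type w) [Field k] where
  /-- the underlying type -/
  carrier : Type (max u w)
  [ring : Ring carrier]
  [algebra : Algebra k carrier]
  /-- the homogeneous component of each degree -/
  piece : ℕ → Submodule k carrier

attribute [instance] GradedAlg.ring GradedAlg.algebra

/-- Isomorphism of graded algebras: there is an isomorphism of (unital) `k`-algebras which maps
each homogeneous component onto the homogeneous component of the same degree. -/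
def GradedAlg.Iso {k : Type w} [Field k] (A B : GradedAlg.{u, w} k) : Prop :=
  ∃ e : A.carrier ≃ₐ[k] B.carrier, ∀ i, (A.piece i).map e.toLinearMap = B.piece i

section

variable {k : Type w} [Field k]

theorem GradedAlg.Iso.refl (A : GradedAlg.{u, w} k) : A.Iso A :=
  ⟨AlgEquiv.refl, fun i => Submodule.map_id (A.piece i)⟩

theorem GradedAlg.Iso.symm {A B : GradedAlg.{u, w} k} (h : A.Iso B) : B.Iso A := by
  obtain ⟨e, he⟩ := h
  refine ⟨e.symm, fun i => ?_⟩
  have h : e.symm.toLinearMap ∘ₗ e.toLinearMap = LinearMap.id :=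
    LinearMap.ext fun x => e.symm_apply_apply x
  rw [← he i, ← Submodule.map_comp, h, Submodule.map_id]

theorem GradedAlg.Iso.trans {A B C : GradedAlg.{u, w} k} (h : A.Iso B) (h' : B.Iso C) :
    A.Iso C := by
  obtain ⟨e, he⟩ := h
  obtain ⟨f, hf⟩ := h'
  refine ⟨e.trans f, fun i => ?_⟩
  rw [← hf i, ← he i, ← Submodule.map_comp]
  rfl

end

/-- The quotient of the path algebra of a quiver by a two-sided ideal `I`; the component of
degree `i` is `(kQ_i + I) / I`, the image of the span of the paths of length `i`. -/
def quotientAlg {k : Type w} [Field k] {Q : Type u} [Quiver.{0} Q] [Fintype Q]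
    (I : TwoSidedIdeal (PathAlgebra k Q)) : GradedAlg.{u, w} k where
  carrier := I.ringCon.Quotient
  piece i := (PathAlgebra.piece k Q i).map (I.ringCon.mkₐ k).toLinearMap

/-- The algebra generated by `1` and `X` with `X ^ 2 = 0`, where `X` has degree two. -/
def oneVertexAlg (k : Type w) [Field k] : GradedAlg.{u, w} k where
  carrier := ULift.{u} (DualNumber k)
  piece i :=
    if i = 0 then Submodule.span k {ULift.up 1}
    else if i = 2 then Submodule.span k {ULift.up DualNumber.eps}
    else ⊥

section

variable {k : Type w} [Field k] {V : Type u} [Fintype V] {Γ : SimpleGraph V}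

/-- The two-sided ideal generated by all paths of length greater than two. -/
def longPathsIdeal (k : Type w) [Field k] (Γ : SimpleGraph V) :
    TwoSidedIdeal (PathAlgebra k (DoubleGraph Γ)) :=
  TwoSidedIdeal.span {x | ∃ (a b : DoubleGraph Γ) (p : Quiver.Path a b),
    2 < p.length ∧ x = PathAlgebra.of k p}

/-- The two-sided ideal `I_v`, generated by the paths `(a | b | c)` with `a ≠ c` and
by the elements `(a | b | a) - v^a_{b,c} (a | c | a)`. -/
def Coefficients.ideal (v : Coefficients k Γ) : TwoSidedIdeal (PathAlgebra k (DoubleGraph Γ)) :=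
  TwoSidedIdeal.span
    ({x | ∃ (a b c : V) (hab : Γ.Adj a b) (hbc : Γ.Adj b c),
        a ≠ c ∧ x = PathAlgebra.of k (path₂ hab hbc)} ∪
      {x | ∃ (a b c : V) (hab : Γ.Adj a b) (hac : Γ.Adj a c),
        x = PathAlgebra.of k (path₂ hab hab.symm) -
          v.coeff a ⟨b, hab⟩ ⟨c, hac⟩ • PathAlgebra.of k (path₂ hac hac.symm)})

/-- The skew-zigzag algebra `A_v(Γ)`. -/
def Coefficients.algebra (v : Coefficients k Γ) : GradedAlg.{u, w} k :=
  if Fintype.card V = 1 then oneVertexAlg k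
  else if Fintype.card V = 2 then quotientAlg (longPathsIdeal k Γ)
  else quotientAlg v.ideal

variable (k Γ)

/-- The set `Σ` of all skew-zigzag algebras of `Γ`. -/
def skewZigzagAlgebras : Set (GradedAlg.{u, w} k) :=
  Set.range (Coefficients.algebra : Coefficients k Γ → GradedAlg.{u, w} k)

/-- Isomorphism of graded algebras, as an equivalence relation on `Σ`. -/
def isoSetoid : Setoid (skewZigzagAlgebras k Γ) where
  r A B := A.1.Iso B.1
  iseqv := ⟨fun A => .refl A.1, fun h => h.symm, fun h h' => h.trans h'⟩

/-- The moduli space of skew-zigzag algebras of `Γ` up to arbitrary isomorphism of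
graded algebras. -/
def Moduli : Type (max u w + 1) := Quotient (isoSetoid k Γ)

variable {k Γ}

/-- The isomorphism class of `A_v(Γ)`. -/
def Coefficients.isoClass (v : Coefficients k Γ) : Moduli k Γ :=
  Quotient.mk (isoSetoid k Γ) ⟨v.algebra, v, rfl⟩

end

/-! ### Graph cohomology and the action of the graph automorphisms -/

section

variable {V : Type u} (Γ : SimpleGraph V)

/-- The relations `(a | b) + (b | a)` in the free abelian group `ℤE'` on the arrows of
the double graph. -/
def edgeRelations : AddSubgroup (Γ.Dart →₀ ℤ) :=
  AddSubgroup.closure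
    (Set.range fun d : Γ.Dart => Finsupp.single d 1 + Finsupp.single d.symm 1)

/-- The group `ℤE' / {(a | b) + (b | a)}`. -/
abbrev ChainGroup : Type u := (Γ.Dart →₀ ℤ) ⧸ edgeRelations Γ

/-- The class of an arrow in the chain group. -/
def arrowClass (d : Γ.Dart) : ChainGroup Γ := QuotientAddGroup.mk (Finsupp.single d 1)

variable {Γ}

/-- A function on the arrows of the double graph which takes opposite values on `(a | b)` and
`(b | a)` extends to the chain group. -/
def chainLift {M : Type*} [AddCommGroup M] (g : Γ.Dart → M) (hg : ∀ d, g d + g d.symm = 0) :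
    ChainGroup Γ →+ M :=
  QuotientAddGroup.lift (edgeRelations Γ)
    (Finsupp.liftAddHom fun d => (zmultiplesHom M) (g d)) <| by
      rw [edgeRelations, AddSubgroup.closure_le]
      rintro _ ⟨d, rfl⟩
      simp [AddMonoidHom.mem_ker, hg]

@[simp]
theorem chainLift_arrowClass {M : Type*} [AddCommGroup M] (g : Γ.Dart → M)
    (hg : ∀ d, g d + g d.symm = 0) (d : Γ.Dart) : chainLift g hg (arrowClass Γ d) = g d := by
  simp [chainLift, arrowClass]

theorem chain_hom_ext {M : Type*} [AddCommGroup M] {f g : ChainGroup Γ →+ M}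
    (h : ∀ d, f (arrowClass Γ d) = g (arrowClass Γ d)) : f = g := by
  refine QuotientAddGroup.addMonoidHom_ext _ (Finsupp.addHom_ext fun d n => ?_)
  have e : (Finsupp.single d n : Γ.Dart →₀ ℤ) = n • Finsupp.single d 1 := by simp
  rw [e, map_zsmul, map_zsmul]
  exact congrArg (n • ·) (h d)

theorem arrowClass_add_symm (d : Γ.Dart) : arrowClass Γ d + arrowClass Γ d.symm = 0 :=
  (QuotientAddGroup.eq_zero_iff _).2 (AddSubgroup.subset_closure ⟨d, rfl⟩)

variable (Γ)

/-- The boundary map `δ`, sending an arrow `e` to `s(e) - t(e)`. -/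
def boundary : ChainGroup Γ →+ (V →₀ ℤ) :=
  chainLift (fun d => Finsupp.single d.fst 1 - Finsupp.single d.snd 1) fun d => by simp

/-- The space of cycles of `Γ`, the kernel of `δ`. -/
def cycleSpace : AddSubgroup (ChainGroup Γ) := (boundary Γ).ker

/-- The graph cohomology `H¹(Γ, kˣ) = Hom(C, kˣ)`, where `C` is the space of cycles. -/
abbrev H1 (k : Type w) [Field k] : Type (max u w) := Multiplicative (cycleSpace Γ) →* kˣ

variable {Γ}

/-- The action of a graph automorphism on chains, `(a | b) ↦ (σ a | σ b)`. -/
def chainMap (σ : Γ ≃g Γ) : ChainGroup Γ →+ ChainGroup Γ :=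
  chainLift (fun d => arrowClass Γ (σ.toHom.mapDart d)) fun d =>
    arrowClass_add_symm (σ.toHom.mapDart d)

@[simp]
theorem chainMap_arrowClass (σ : Γ ≃g Γ) (d : Γ.Dart) :
    chainMap σ (arrowClass Γ d) = arrowClass Γ (σ.toHom.mapDart d) :=
  chainLift_arrowClass _ _ d

theorem chainMap_one (z : ChainGroup Γ) : chainMap (1 : Γ ≃g Γ) z = z := by
  have h : chainMap (1 : Γ ≃g Γ) = AddMonoidHom.id _ :=
    chain_hom_ext fun d => chainMap_arrowClass 1 d
  exact congrArg (fun F => F z) h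

theorem chainMap_mul (σ τ : Γ ≃g Γ) (z : ChainGroup Γ) :
    chainMap (σ * τ) z = chainMap σ (chainMap τ z) := by
  have h : chainMap (σ * τ) = (chainMap σ).comp (chainMap τ) :=
    chain_hom_ext fun d => by
      rw [AddMonoidHom.comp_apply, chainMap_arrowClass, chainMap_arrowClass, chainMap_arrowClass]
      rfl
  exact congrArg (fun F => F z) h

theorem chainMap_mem (σ : Γ ≃g Γ) {z : ChainGroup Γ} (hz : z ∈ cycleSpace Γ) :
    chainMap σ z ∈ cycleSpace Γ := by
  have h : (boundary Γ).comp (chainMap σ) =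
      (Finsupp.mapDomain.addMonoidHom σ).comp (boundary Γ) :=
    chain_hom_ext fun d => by
      simp [boundary, Finsupp.mapDomain_single, sub_eq_add_neg, ← Finsupp.single_neg,
        Finsupp.mapDomain_add]
  have h' := congrArg (fun F => F z) h
  simp only [AddMonoidHom.comp_apply] at h'
  rw [cycleSpace, AddMonoidHom.mem_ker] at hz ⊢
  rw [h', hz, map_zero]

/-- The action of a graph automorphism on the space of cycles. -/
def cycleMap (σ : Γ ≃g Γ) : cycleSpace Γ →+ cycleSpace Γ :=
  ((chainMap σ).comp (cycleSpace Γ).subtype).codRestrict (cycleSpace Γ)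
    fun z => chainMap_mem σ z.2

/-- The action of `Aut(Γ)` on the graph cohomology: `(σ f)(C) = f (σ⁻¹ C)`. -/
instance (k : Type w) [Field k] : MulAction (Γ ≃g Γ) (H1 Γ k) where
  smul σ f := f.comp (AddMonoidHom.toMultiplicative (cycleMap σ⁻¹))
  one_smul f := by
    refine MonoidHom.ext fun z => congrArg f ?_
    refine congrArg Multiplicative.ofAdd (Subtype.ext ?_)
    exact (congrArg (fun τ : Γ ≃g Γ => chainMap τ z.toAdd.1) inv_one).trans (chainMap_one _)
  mul_smul σ τ f := by
    refine MonoidHom.ext fun z => congrArg f ?_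
    refine congrArg Multiplicative.ofAdd (Subtype.ext ?_)
    exact (congrArg (fun ρ : Γ ≃g Γ => chainMap ρ z.toAdd.1) (mul_inv_rev σ τ)).trans
      (chainMap_mul _ _ _)

theorem smul_apply (k : Type w) [Field k] (σ : Γ ≃g Γ) (f : H1 Γ k) (z : cycleSpace Γ) :
    (σ • f) (Multiplicative.ofAdd z) = f (Multiplicative.ofAdd (cycleMap σ⁻¹ z)) := rfl

/-- The set `H¹(Γ, kˣ) / Aut(Γ)` of orbits. -/
abbrev H1Orbits (Γ : SimpleGraph V) (k : Type w) [Field k] : Type (max u w) :=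
  MulAction.orbitRel.Quotient (Γ ≃g Γ) (H1 Γ k)

end

/-! ### The cohomology class of a collection of skew-zigzag coefficients -/

section

variable {k : Type w} [Field k] {V : Type u} {Γ : SimpleGraph V}

namespace Coefficients

/-- The coefficient `v^a_{b,c}` as a unit of `k`. -/
def unit (v : Coefficients k Γ) (a : V) (b c : Γ.neighborSet a) : kˣ :=
  ⟨v.coeff a b c, v.coeff a c b, v.coeff_mul_symm a b c, v.coeff_mul_symm a c b⟩

theorem unit_mul_unit (v : Coefficients k Γ) (a : V) (b c d : Γ.neighborSet a) :
    v.unit a b c * v.unit a c d = v.unit a b d := by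
  have h : v.unit a b c * v.unit a c d * v.unit a d b = 1 := Units.ext (v.coeff_cycle a b c d)
  have h' : v.unit a b d * v.unit a d b = 1 := Units.ext (v.coeff_mul_symm a b d)
  exact mul_right_cancel (h.trans h'.symm)

/-- The coefficient `v^a_{r,b}`, where `r` is a neighbour of `a` that depends on `a` only. -/
def half (v : Coefficients k Γ) (a : V) (b : Γ.neighborSet a) : kˣ :=
  v.unit a (Classical.choice ⟨b⟩) b

theorem unit_eq (v : Coefficients k Γ) (a : V) (b c : Γ.neighborSet a) :
    v.unit a b c = v.half a c / v.half a b := by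
  rw [eq_div_iff_mul_eq', half, half, mul_comm, unit_mul_unit]

/-- The contribution of the arrow `(a | b)` to `f_v`: the product of `v^a_{r,b}` and `v^b_{a,s}`
for a neighbour `r` of `a` and a neighbour `s` of `b` chosen once and for all. -/
def weight (v : Coefficients k Γ) (d : Γ.Dart) : kˣ :=
  v.half d.fst ⟨d.snd, d.adj⟩ / v.half d.snd ⟨d.fst, d.adj.symm⟩

/-- The homomorphism on all chains which restricts to `f_v`. -/
def chainHom (v : Coefficients k Γ) : ChainGroup Γ →+ Additive kˣ :=
  chainLift (fun d => Additive.ofMul (v.weight d)) fun d => by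
    rw [← ofMul_mul, weight, weight]
    exact congrArg Additive.ofMul (div_mul_div_cancel _ _ _ |>.trans (div_self' _))

/-- The element `f_v` of `H¹(Γ, kˣ)` attached to the collection `v`. On a cycle `z` represented
by `∑ α(e) e` with `α(e) ∈ ℕ`, it is the product over all the vertices `a` of
`∏ i, v^a_{b_i,c_i}`, where the `(b_i | a)` are the arrows into `a`, the `(a | c_i)` are
the arrows out of `a` (both with multiplicities `α`), and they are paired in any way:
see `cohomologyClass_apply`. On the class of a closed path it is the cycle product of `v` along
that path: see `cohomologyClass_closedWalk`. -/
def cohomologyClass (v : Coefficients k Γ) : H1 Γ k :=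
  AddMonoidHom.toMultiplicativeLeft (v.chainHom.comp (cycleSpace Γ).subtype)

theorem cohomologyClass_ofAdd (v : Coefficients k Γ) (z : cycleSpace Γ) :
    v.cohomologyClass (Multiplicative.ofAdd z) = (v.chainHom z).toMul := rfl

theorem chainHom_arrowClass (v : Coefficients k Γ) (d : Γ.Dart) :
    (v.chainHom (arrowClass Γ d)).toMul = v.weight d := by
  rw [chainHom, chainLift_arrowClass, toMul_ofMul]

open Classical in
theorem cohomologyClass_apply [Fintype V] (v : Coefficients k Γ) (z : cycleSpace Γ)
    (α : Γ.Dart → ℕ) (hα : (z : ChainGroup Γ) = ∑ d, α d • arrowClass Γ d)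
    (P : (a : V) → Multiset (Γ.neighborSet a × Γ.neighborSet a))
    (hin : ∀ a, (P a).map Prod.fst =
      ∑ b : Γ.neighborSet a, Multiset.replicate (α ⟨(b.1, a), b.2.symm⟩) b)
    (hout : ∀ a, (P a).map Prod.snd =
      ∑ c : Γ.neighborSet a, Multiset.replicate (α ⟨(a, c.1), c.2⟩) c) :
    v.cohomologyClass (Multiplicative.ofAdd z) =
      ∏ a, ((P a).map fun x => v.unit a x.1 x.2).prod := by
  have hsum : ∀ (a : V) (m : Γ.neighborSet a → ℕ),
      ((∑ b : Γ.neighborSet a, Multiset.replicate (m b) b).map (v.half a)).prod =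
        ∏ b : Γ.neighborSet a, v.half a b ^ m b := by
    intro a m
    have := map_sum (Multiset.mapAddMonoidHom (v.half a))
      (fun b : Γ.neighborSet a => Multiset.replicate (m b) b) Finset.univ
    simp only [Multiset.coe_mapAddMonoidHom] at this
    rw [this, Multiset.prod_sum]
    simp
  have hP : ∀ a, ((P a).map fun x => v.unit a x.1 x.2).prod =
      (∏ c : Γ.neighborSet a, v.half a c ^ α ⟨(a, c.1), c.2⟩) /
        ∏ b : Γ.neighborSet a, v.half a b ^ α ⟨(b.1, a), b.2.symm⟩ := by
    intro a
    rw [← hsum, ← hsum, ← hin, ← hout, Multiset.map_map, Multiset.map_map,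
      ← Multiset.prod_map_div]
    simp only [unit_eq, Function.comp_apply]
  let e : (Σ a, Γ.neighborSet a) ≃ Γ.Dart :=
    { toFun := fun x => ⟨(x.1, x.2.1), x.2.2⟩
      invFun := fun d => ⟨d.fst, d.snd, d.adj⟩
      left_inv := fun _ => rfl
      right_inv := fun _ => rfl }
  let e' : Γ.Dart ≃ Γ.Dart :=
    { toFun := fun d => d.symm
      invFun := fun d => d.symm
      left_inv := fun d => d.symm_symm
      right_inv := fun d => d.symm_symm }
  have hout' : ∏ a, ∏ c : Γ.neighborSet a, v.half a c ^ α ⟨(a, c.1), c.2⟩ =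
      ∏ d : Γ.Dart, v.half d.fst ⟨d.snd, d.adj⟩ ^ α d := by
    rw [← Fintype.prod_sigma']
    exact Fintype.prod_equiv e _ _ fun x => rfl
  have hin' : ∏ a, ∏ b : Γ.neighborSet a, v.half a b ^ α ⟨(b.1, a), b.2.symm⟩ =
      ∏ d : Γ.Dart, v.half d.snd ⟨d.fst, d.adj.symm⟩ ^ α d := by
    rw [← Fintype.prod_sigma']
    exact Fintype.prod_equiv (e.trans e') _ _ fun x => rfl
  rw [cohomologyClass_ofAdd, hα, map_sum, toMul_sum]
  simp only [hP, Finset.prod_div_distrib, hout', hin', map_nsmul, toMul_nsmul,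
    chainHom_arrowClass, weight, div_pow]

open Classical in
/-- The coefficient `v^a_{b,c}` if `b` and `c` are neighbours of `a` (and `1` otherwise). -/
def val (v : Coefficients k Γ) (a b c : V) : kˣ :=
  if h : Γ.Adj a b ∧ Γ.Adj a c then v.unit a ⟨b, h.1⟩ ⟨c, h.2⟩ else 1

/-- The cycle product of `v` along a closed path `p₀, p₁, …, pₙ = p₀`: the product of
the coefficients `v^{p_i}_{p_{i-1},p_{i+1}}` for `0 ≤ i < n`, with `p_{-1} = p_{n-1}`. -/
def cycleProduct (v : Coefficients k Γ) {a : V} (p : Γ.Walk a a) : kˣ :=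
  ∏ i ∈ Finset.range p.length,
    v.val (p.getVert i) (p.getVert ((i + (p.length - 1)) % p.length)) (p.getVert (i + 1))

end Coefficients

/-- The chain `∑ (a_i | a_{i+1})` of a path. -/
def walkClass {a b : V} (p : Γ.Walk a b) : ChainGroup Γ := (p.darts.map (arrowClass Γ)).sum

theorem boundary_walkClass {a b : V} (p : Γ.Walk a b) :
    boundary Γ (walkClass p) = Finsupp.single a 1 - Finsupp.single b 1 := by
  induction p with
  | nil => simp [walkClass]
  | cons h p ih =>
    have : walkClass (SimpleGraph.Walk.cons h p) = arrowClass Γ ⟨(_, _), h⟩ + walkClass p := by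
      simp [walkClass]
    rw [this, map_add, ih, boundary, chainLift_arrowClass]
    simp

theorem walkClass_mem {a : V} (p : Γ.Walk a a) : walkClass p ∈ cycleSpace Γ := by
  rw [cycleSpace, AddMonoidHom.mem_ker, boundary_walkClass, sub_self]

namespace Coefficients

open Classical in
theorem cohomologyClass_closedWalk (v : Coefficients k Γ) {a : V} (p : Γ.Walk a a) :
    v.cohomologyClass (Multiplicative.ofAdd ⟨walkClass p, walkClass_mem p⟩) =
      v.cycleProduct p := by
  let H : V → V → kˣ := fun a b => if h : Γ.Adj a b then v.half a ⟨b, h⟩ else 1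
  have hval : ∀ a b c, Γ.Adj a b → Γ.Adj a c → v.val a b c = H a c / H a b := by
    intro a b c hb hc
    simp only [val, H, dif_pos hb, dif_pos hc, dif_pos (And.intro hb hc), unit_eq]
  have hw : ∀ d : Γ.Dart, v.weight d = H d.fst d.snd / H d.snd d.fst := by
    intro d
    simp only [weight, H, dif_pos d.adj, dif_pos d.adj.symm]
  have hp : ∀ {a b : V} (p : Γ.Walk a b), (v.chainHom (walkClass p)).toMul =
      (∏ i ∈ Finset.range p.length, H (p.getVert i) (p.getVert (i + 1))) /
        ∏ i ∈ Finset.range p.length, H (p.getVert (i + 1)) (p.getVert i) := by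
    intro a b p
    induction p with
    | nil => simp [walkClass]
    | cons h p ih =>
      have : walkClass (SimpleGraph.Walk.cons h p) = arrowClass Γ ⟨(_, _), h⟩ + walkClass p := by
        simp [walkClass]
      rw [this, map_add, toMul_add, ih, chainHom_arrowClass, hw, SimpleGraph.Walk.length_cons,
        Finset.prod_range_succ', Finset.prod_range_succ']
      simp only [SimpleGraph.Walk.getVert_cons_succ, SimpleGraph.Walk.getVert_zero]
      rw [div_mul_div_comm, mul_comm (H _ _), mul_comm (H _ _)]
  rw [cohomologyClass_ofAdd, hp, cycleProduct]
  obtain hn | ⟨n, hn⟩ : p.length = 0 ∨ ∃ n, p.length = n + 1 := by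
    cases p.length with
    | zero => exact Or.inl rfl
    | succ n => exact Or.inr ⟨n, rfl⟩
  · simp [hn]
  · have hadj : ∀ i ∈ Finset.range (n + 1), v.val (p.getVert i)
        (p.getVert ((i + n) % (n + 1))) (p.getVert (i + 1)) =
        H (p.getVert i) (p.getVert (i + 1)) /
          H (p.getVert i) (p.getVert ((i + n) % (n + 1))) := by
      intro i hi
      have hi' : i < p.length := by rw [hn]; exact Finset.mem_range.1 hi
      refine hval _ _ _ ?_ (p.adj_getVert_succ hi')
      cases i with
      | zero =>
        have h1 := p.adj_getVert_succ (i := n) (by omega)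
        rw [← hn, SimpleGraph.Walk.getVert_length] at h1
        rw [Nat.zero_add, Nat.mod_eq_of_lt (Nat.lt_succ_self n), SimpleGraph.Walk.getVert_zero]
        exact h1.symm
      | succ j =>
        have h1 := p.adj_getVert_succ (i := j) (by omega)
        have h2 : (j + 1 + n) % (n + 1) = j := by
          rw [show j + 1 + n = j + (n + 1) by omega, Nat.add_mod_right,
            Nat.mod_eq_of_lt (by omega)]
        rw [h2]
        exact h1.symm
    rw [hn, Nat.add_sub_cancel, Finset.prod_congr rfl hadj, Finset.prod_div_distrib]
    congr 1
    rw [Finset.prod_range_succ, Finset.prod_range_succ']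
    congr 1
    · refine Finset.prod_congr rfl fun j hj => ?_
      have h2 : (j + 1 + n) % (n + 1) = j := by
        have := Finset.mem_range.1 hj
        rw [show j + 1 + n = j + (n + 1) by omega, Nat.add_mod_right,
          Nat.mod_eq_of_lt (by omega)]
      rw [h2]
    · rw [← hn, SimpleGraph.Walk.getVert_length, hn, Nat.zero_add,
        Nat.mod_eq_of_lt (Nat.lt_succ_self n), SimpleGraph.Walk.getVert_zero]

end Coefficients

end

end SkewZigzag

end

/-!
A collection `v` can be written as `v^a_{b,c} = half a c / half a b`, where `half` depends on the
choice of a neighbour of each vertex, and `f_v` is the restriction to the cycles of the homomorphism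
with value `half a b / half b a` on the arrow `(a | b)`. Both halves of the proof compare `v` and `w`
along a graph automorphism `σ` by means of a gauge transformation (`IsGauge`): a function `μ` on the
edges with `v^a_{b,c} μ(a, c) = w^{σ a}_{σ b, σ c} μ(a, b)`.

*Gauge transformations and cohomology.* Walks to a base point in each component yield a projection
`cycleProj` of the chains onto the cycles. Hence a homomorphism on the chains that vanishes on the
cycles is a coboundary (`exists_potential`), so that a gauge transformation along `σ` exists if and
only if `f_v = σ⁻¹ f_w` (`Coefficients.exists_isGauge_iff`), and every homomorphism on the cycles
extends to the chains and is of the form `f_v` (`Coefficients.cohomologyClass_surjective`).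

*Gauge transformations and isomorphisms.* Let `A_v` be the quotient of the path algebra by `I_v`.
If `μ(a, b) = λ(a, b) λ(b, a)`, then `(a | b) ↦ λ(a, b) (σ a | σ b)` defines a graded isomorphism
`A_v ≅ A_w` (`IsGauge.iso`); such a `λ` is `μ` on one orientation of each edge and `1` on the
other. Conversely, a graded isomorphism permutes the vertex idempotents, because these form the
only complete family of nonzero orthogonal idempotents in degree zero indexed by the vertices, up
to order. It therefore rescales the arrows, and since the loops `(a | b | a)` are nonzero in `A_w`,
comparing their images shows that `μ(a, b) = λ(a, b) λ(b, a)` is a gauge transformation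
(`exists_isGauge_of_iso`). That vertices, arrows and loops are nonzero modulo `I_v` is seen by
linear functionals that vanish on `I_v` (`Coefficients.eq_zero_of_mem_ideal`).

If there are at most two vertices, then all the coefficients are `1`, and only the class of one
algebra and one orbit remain. In all cases, the classes of algebras and the orbits are the fibres
of the same equivalence relation on the collections of coefficients.
-/

noncomputable section

namespace SkewZigzag

/-! ### Chains, cycles and gauge transformations -/

section Cohomology

variable {V : Type u} {Γ : SimpleGraph V}

/-- A base point of the connected component of a vertex. -/
def root (Γ : SimpleGraph V) (a : V) : V := (Γ.connectedComponentMk a).out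

theorem reachable_root (a : V) : Γ.Reachable a (root Γ a) :=
  SimpleGraph.ConnectedComponent.exact (Quot.out_eq (Γ.connectedComponentMk a)).symm

theorem root_eq_of_adj {a b : V} (h : Γ.Adj a b) : root Γ a = root Γ b :=
  congrArg Quot.out (SimpleGraph.ConnectedComponent.sound h.reachable)

/-- The chain of a walk from a vertex to the base point of its component. -/
def rootChain (a : V) : ChainGroup Γ := walkClass (reachable_root (Γ := Γ) a).some

theorem boundary_rootChain (a : V) :
    boundary Γ (rootChain a) = Finsupp.single a 1 - Finsupp.single (root Γ a) 1 :=
  boundary_walkClass _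

/-- The extension of `rootChain` to a homomorphism. On the image of the boundary map it is a
section of the boundary map, see `boundary_rootHom_boundary`. -/
def rootHom (Γ : SimpleGraph V) : (V →₀ ℤ) →+ ChainGroup Γ :=
  Finsupp.liftAddHom fun a => zmultiplesHom (ChainGroup Γ) (rootChain a)

@[simp]
theorem rootHom_single (a : V) : rootHom Γ (Finsupp.single a 1) = rootChain a := by
  simp [rootHom]

theorem boundary_arrowClass (d : Γ.Dart) :
    boundary Γ (arrowClass Γ d) = Finsupp.single d.fst 1 - Finsupp.single d.snd 1 := by
  rw [boundary, chainLift_arrowClass]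

theorem boundary_rootHom_boundary (z : ChainGroup Γ) :
    boundary Γ (rootHom Γ (boundary Γ z)) = boundary Γ z := by
  have h : ((boundary Γ).comp (rootHom Γ)).comp (boundary Γ) = boundary Γ :=
    chain_hom_ext fun d => by
      simp only [AddMonoidHom.comp_apply, boundary_arrowClass, map_sub, rootHom_single,
        boundary_rootChain, root_eq_of_adj d.adj, sub_sub_sub_cancel_right]
  exact congrArg (fun F => F z) h

/-- The projection `z ↦ z - rootHom (boundary z)` of the chains onto the cycles. -/
def cycleProj (Γ : SimpleGraph V) : ChainGroup Γ →+ cycleSpace Γ :=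
  (AddMonoidHom.id _ - (rootHom Γ).comp (boundary Γ)).codRestrict (cycleSpace Γ) fun z => by
    rw [cycleSpace, AddMonoidHom.mem_ker, AddMonoidHom.sub_apply, map_sub, AddMonoidHom.comp_apply,
      boundary_rootHom_boundary]
    exact sub_self _

theorem cycleProj_coe (z : cycleSpace Γ) : cycleProj Γ z = z := by
  have hz : boundary Γ (z : ChainGroup Γ) = 0 := z.2
  refine Subtype.ext ?_
  change (z : ChainGroup Γ) - rootHom Γ (boundary Γ z) = z
  rw [hz, map_zero, sub_zero]

/-- Homomorphisms from the chains that vanish on the cycles are coboundaries. -/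
theorem exists_potential {M : Type*} [AddCommGroup M] (D : ChainGroup Γ →+ M)
    (hD : ∀ z ∈ cycleSpace Γ, D z = 0) :
    ∃ g : V → M, ∀ d : Γ.Dart, D (arrowClass Γ d) = g d.fst - g d.snd := by
  refine ⟨fun a => D (rootChain a), fun d => ?_⟩
  have h := hD _ (cycleProj Γ (arrowClass Γ d)).2
  change D (arrowClass Γ d - rootHom Γ (boundary Γ (arrowClass Γ d))) = 0 at h
  rw [boundary_arrowClass, map_sub D, map_sub (rootHom Γ), rootHom_single, rootHom_single,
    map_sub D] at h
  exact sub_eq_zero.1 h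

theorem eq_zero_of_potential {M : Type*} [AddCommGroup M] (D : ChainGroup Γ →+ M) (g : V → M)
    (hg : ∀ d : Γ.Dart, D (arrowClass Γ d) = g d.fst - g d.snd) {z : ChainGroup Γ}
    (hz : z ∈ cycleSpace Γ) : D z = 0 := by
  have h : D = (Finsupp.liftAddHom fun a => zmultiplesHom M (g a)).comp (boundary Γ) :=
    chain_hom_ext fun d => by
      rw [AddMonoidHom.comp_apply, boundary_arrowClass, map_sub, hg]
      simp
  have hz' : boundary Γ z = 0 := hz
  rw [h, AddMonoidHom.comp_apply, hz', map_zero]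

variable {k : Type w} [Field k]

/-- Half weights `h(a, b)` of the arrows determine the coefficients
`v^a_{b,c} = h(a, c) / h(a, b)`. -/
def Coefficients.ofHalf (h : V → V → kˣ) : Coefficients k Γ where
  coeff a b c := ((h a c / h a b : kˣ) : k)
  coeff_self a b := by simp
  coeff_mul_symm a b c := by
    rw [← Units.val_mul, div_mul_div_cancel, div_self', Units.val_one]
  coeff_cycle a b c d := by
    rw [← Units.val_mul, ← Units.val_mul, mul_comm (h a c / h a b), div_mul_div_cancel,
      div_mul_div_cancel, div_self', Units.val_one]

theorem Coefficients.unit_ofHalf (h : V → V → kˣ) (a : V) (b c : Γ.neighborSet a) :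
    (ofHalf h : Coefficients k Γ).unit a b c = h a c / h a b := Units.ext rfl

/-- A choice of one of the two orientations of each pair of vertices. With its help, symmetric
functions on the edges are written as `λ(a, b) λ(b, a)` and antisymmetric ones as
`h(a, b) / h(b, a)`, with the factor `1` on one of the two orientations. -/
theorem exists_orientation (V : Type*) :
    ∃ r : V → V → Prop, ∀ a b, a ≠ b → (r a b ∧ ¬ r b a) ∨ (r b a ∧ ¬ r a b) := by
  refine ⟨WellOrderingRel, fun a b hab => ?_⟩
  rcases trichotomous_of WellOrderingRel a b with h | h | h
  · exact Or.inl ⟨h, asymm h⟩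
  · exact absurd h hab
  · exact Or.inr ⟨h, asymm h⟩

/-- A homomorphism on the cycles extends to the chains, and any antisymmetric weights on the arrows
come from coefficients. -/
theorem Coefficients.cohomologyClass_surjective :
    Function.Surjective (cohomologyClass : Coefficients k Γ → H1 Γ k) := by
  classical
  intro f
  let F : ChainGroup Γ →+ Additive kˣ :=
    (AddMonoidHom.toMultiplicativeLeft.symm f).comp (cycleProj Γ)
  obtain ⟨r, hr⟩ := exists_orientation V
  let h : V → V → kˣ := fun a b =>
    if hab : Γ.Adj a b ∧ r a b then (F (arrowClass Γ ⟨(a, b), hab.1⟩)).toMul else 1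
  have hh : ∀ d : Γ.Dart, h d.fst d.snd / h d.snd d.fst = (F (arrowClass Γ d)).toMul := by
    intro d
    have hs : F (arrowClass Γ d) = - F (arrowClass Γ d.symm) := by
      rw [eq_neg_iff_add_eq_zero, ← map_add, arrowClass_add_symm, map_zero]
    rcases hr d.fst d.snd d.adj.ne with ⟨h1, h2⟩ | ⟨h1, h2⟩
    · simp only [h]
      rw [dif_pos ⟨d.adj, h1⟩, dif_neg fun h => h2 h.2, div_one]
    · simp only [h]
      rw [dif_neg fun h => h2 h.2, dif_pos ⟨d.adj.symm, h1⟩, hs, one_div]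
      rfl
  refine ⟨ofHalf h, ?_⟩
  refine MonoidHom.ext fun z => ?_
  obtain ⟨z, rfl⟩ := Multiplicative.ofAdd.surjective z
  rw [cohomologyClass_ofAdd]
  have hF : (F z).toMul = f (Multiplicative.ofAdd z) := by
    change f (Multiplicative.ofAdd (cycleProj Γ z)) = _
    rw [cycleProj_coe]
  -- the reference neighbour in `half` changes the weights by a coboundary only
  have hc : ∀ a, ∃ c : kˣ, ∀ b : Γ.neighborSet a, (ofHalf h : Coefficients k Γ).half a b =
      h a b / c := by
    intro a
    by_cases ha : Nonempty (Γ.neighborSet a)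
    · exact ⟨h a (Classical.choice ha : Γ.neighborSet a), fun b => unit_ofHalf h a _ b⟩
    · exact ⟨1, fun b => absurd ⟨b⟩ ha⟩
  choose c hc using hc
  have hz := eq_zero_of_potential ((ofHalf h : Coefficients k Γ).chainHom - F)
    (fun a => Additive.ofMul (c a)⁻¹) (fun d => ?_) z.2
  · rw [← hF]
    exact congrArg Additive.toMul (sub_eq_zero.1 hz)
  apply Additive.toMul.injective
  have hdiv : ∀ x y p q : kˣ, x / p / (y / q) / (x / y) = p⁻¹ / q⁻¹ := fun x y p q => by
    rw [div_div_div_comm x p y q, div_right_comm, div_self', one_div, inv_div, inv_div_inv]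
  rw [AddMonoidHom.sub_apply, toMul_sub, toMul_sub, chainHom_arrowClass, ← hh, weight, hc, hc]
  exact hdiv _ _ _ _

/-- A gauge transformation from `v` to `w` along a graph automorphism `σ`: a symmetric function `μ`
on the edges with `v^a_{b,c} μ(a, c) = w^{σ a}_{σ b, σ c} μ(a, b)`. These are the conditions for
`(a | b) ↦ λ(a, b) (σ a | σ b)` with `λ(a, b) λ(b, a) = μ(a, b)` to respect the relations. -/
structure IsGauge (v w : Coefficients k Γ) (σ : Γ ≃g Γ) (μ : V → V → kˣ) : Prop where
  symm : ∀ a b, Γ.Adj a b → μ a b = μ b a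
  rel : ∀ a b c (hb : Γ.Adj a b) (hc : Γ.Adj a c),
    v.unit a ⟨b, hb⟩ ⟨c, hc⟩ * μ a c =
      w.unit (σ a) ⟨σ b, σ.map_adj_iff.2 hb⟩ ⟨σ c, σ.map_adj_iff.2 hc⟩ * μ a b

theorem IsGauge.inv {v w : Coefficients k Γ} {σ : Γ ≃g Γ} {μ : V → V → kˣ}
    (h : IsGauge v w σ μ) :
    IsGauge w v σ.symm fun a b => (μ (σ.symm a) (σ.symm b))⁻¹ where
  symm a b hab := congrArg _ (h.symm _ _ (σ.symm.map_adj_iff.2 hab))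
  rel a b c hb hc := by
    have := h.rel (σ.symm a) (σ.symm b) (σ.symm c) (σ.symm.map_adj_iff.2 hb)
      (σ.symm.map_adj_iff.2 hc)
    rw [← div_eq_mul_inv, ← div_eq_mul_inv, div_eq_div_iff_mul_eq_mul, this]
    have hu : ∀ a' (ha : a' = a) b' (hb' : b' = b) c' (hc' : c' = c) (h1 : Γ.Adj a' b')
        (h2 : Γ.Adj a' c'), w.unit a' ⟨b', h1⟩ ⟨c', h2⟩ = w.unit a ⟨b, hb⟩ ⟨c, hc⟩ := by
      rintro _ rfl _ rfl _ rfl _ _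
      rfl
    rw [hu _ (σ.apply_symm_apply a) _ (σ.apply_symm_apply b) _ (σ.apply_symm_apply c)]

theorem Coefficients.exists_isGauge_iff (v w : Coefficients k Γ) (σ : Γ ≃g Γ) :
    (∃ μ, IsGauge v w σ μ) ↔ v.cohomologyClass = σ⁻¹ • w.cohomologyClass := by
  classical
  -- `f_v = σ⁻¹ f_w` says that `D` vanishes on the cycles, that is, that `D` is a coboundary
  let D : ChainGroup Γ →+ Additive kˣ := v.chainHom - w.chainHom.comp (chainMap σ)
  have hD : (∀ z ∈ cycleSpace Γ, D z = 0) ↔ v.cohomologyClass = σ⁻¹ • w.cohomologyClass := by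
    rw [MonoidHom.ext_iff, Multiplicative.ofAdd.surjective.forall]
    simp only [smul_apply, inv_inv, cohomologyClass_ofAdd, Subtype.forall]
    refine forall₂_congr fun z hz => ?_
    rw [Additive.toMul.injective.eq_iff]
    exact sub_eq_zero
  have hDd : ∀ d : Γ.Dart, (D (arrowClass Γ d)).toMul =
      v.weight d / w.weight (σ.toHom.mapDart d) := by
    intro d
    rw [AddMonoidHom.sub_apply, AddMonoidHom.comp_apply, chainMap_arrowClass, toMul_sub,
      chainHom_arrowClass, chainHom_arrowClass]
  let H : V → V → kˣ := fun a b => if h : Γ.Adj a b then v.half a ⟨b, h⟩ else 1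
  let K : V → V → kˣ := fun a b =>
    if h : Γ.Adj a b then w.half (σ a) ⟨σ b, σ.map_adj_iff.2 h⟩ else 1
  have hDd' : ∀ a b (h : Γ.Adj a b), (D (arrowClass Γ ⟨(a, b), h⟩)).toMul =
      H a b / H b a / (K a b / K b a) := by
    intro a b h
    rw [hDd]
    simp only [weight, H, K, dif_pos h, dif_pos h.symm]
    rfl
  have hrel : ∀ a b c (hb : Γ.Adj a b) (hc : Γ.Adj a c) (x y : kˣ),
      v.unit a ⟨b, hb⟩ ⟨c, hc⟩ * x =
        w.unit (σ a) ⟨σ b, σ.map_adj_iff.2 hb⟩ ⟨σ c, σ.map_adj_iff.2 hc⟩ * y ↔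
      H a c / K a c * x = H a b / K a b * y := by
    intro a b c hb hc x y
    simp only [unit_eq, H, K, dif_pos hb, dif_pos hc]
    generalize v.half a ⟨b, hb⟩ = p
    generalize v.half a ⟨c, hc⟩ = q
    generalize w.half (σ a) _ = r
    generalize w.half (σ a) _ = s
    rw [div_mul_eq_mul_div, div_mul_eq_mul_div, div_eq_div_iff_mul_eq_mul,
      div_mul_eq_mul_div, div_mul_eq_mul_div, div_eq_div_iff_mul_eq_mul]
    rw [mul_right_comm p y r, mul_comm (r * y), ← mul_assoc]
  rw [← hD]
  constructor
  · rintro ⟨μ, hμ⟩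
    -- the gauge condition says that this expression does not depend on `b`;
    -- it is the potential of `D`
    have hg : ∀ a, ∃ g : kˣ, ∀ b, Γ.Adj a b → H a b / K a b * μ a b = g := by
      intro a
      by_cases ha : ∃ b, Γ.Adj a b
      · obtain ⟨b, hb⟩ := ha
        exact ⟨_, fun c hc => ((hrel a c b hc hb _ _).1 (hμ.rel a c b hc hb)).symm⟩
      · exact ⟨1, fun b hb => absurd ⟨b, hb⟩ ha⟩
    choose g hg using hg
    refine fun z => eq_zero_of_potential D (fun a => Additive.ofMul (g a)) fun d => ?_
    apply Additive.toMul.injective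
    rw [toMul_sub, toMul_ofMul, toMul_ofMul, ← hg _ _ d.adj, ← hg _ _ d.adj.symm,
      hμ.symm _ _ d.adj, mul_div_mul_right_eq_div]
    rw [div_div_div_comm]
    exact hDd' _ _ d.adj
  · intro h
    obtain ⟨g, hg⟩ := exists_potential D h
    refine ⟨fun a b => K a b / H a b * (g a).toMul, ⟨fun a b hab => ?_, fun a b c hb hc => ?_⟩⟩
    · have h1 := hDd' a b hab
      rw [hg, toMul_sub, div_div_div_comm] at h1
      have h2 := div_eq_div_iff_mul_eq_mul.1 h1
      rw [← inv_div (H a b), ← inv_div (H b a), inv_mul_eq_iff_eq_mul, mul_left_comm,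
        eq_inv_mul_iff_mul_eq, mul_comm]
      simpa [mul_comm] using h2
    · rw [hrel, ← mul_assoc, ← mul_assoc, div_mul_div_cancel, div_mul_div_cancel, div_self',
        div_self']

end Cohomology

/-! ### The universal property of the path algebra and the ideal of relations -/

namespace PathAlgebra

section Lift

variable {k : Type w} [Field k] {Q : Type u} [Quiver.{0} Q]
variable {B : Type*} [Ring B] [Algebra k B]

/-- The product in `B` of the images `x e` of the arrows `e` of a path; a trivial path `(a)` is
sent to `ε a`. -/
def evalPath (ε : Q → B) (x : ∀ a b : Q, (a ⟶ b) → B) {a : Q} : ∀ {b : Q}, Quiver.Path a b → B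
  | _, .nil => ε a
  | _, .cons p e => evalPath ε x p * x _ _ e

variable {ε : Q → B} {x : ∀ a b : Q, (a ⟶ b) → B}

theorem evalPath_mul_idem (hi : ∀ a, ε a * ε a = ε a)
    (hr : ∀ a b e, x a b e * ε b = x a b e) {a b : Q} (p : Quiver.Path a b) :
    evalPath ε x p * ε b = evalPath ε x p := by
  cases p with
  | nil => exact hi a
  | cons p e => rw [evalPath, mul_assoc, hr]

theorem idem_mul_evalPath (hi : ∀ a, ε a * ε a = ε a) {a b : Q} (p : Quiver.Path a b) :
    ε a * evalPath ε x p = evalPath ε x p := by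
  induction p with
  | nil => exact hi a
  | cons p e ih => rw [evalPath, ← mul_assoc, ih]

theorem evalPath_comp (hi : ∀ a, ε a * ε a = ε a) (hr : ∀ a b e, x a b e * ε b = x a b e)
    {a b c : Q} (p : Quiver.Path a b) (q : Quiver.Path b c) :
    evalPath ε x (p.comp q) = evalPath ε x p * evalPath ε x q := by
  induction q with
  | nil => rw [Quiver.Path.comp_nil, evalPath, evalPath_mul_idem hi hr]
  | cons q e ih => rw [Quiver.Path.comp_cons, evalPath, ih, evalPath, mul_assoc]

/-- A linear map out of the path algebra given by its values on paths. -/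
def linearLift {M : Type*} [AddCommGroup M] [Module k M] (t : TotalPath Q → M) :
    PathAlgebra k Q →ₗ[k] M :=
  Finsupp.linearCombination k (M := M) t

@[simp]
theorem linearLift_of {M : Type*} [AddCommGroup M] [Module k M] (t : TotalPath Q → M) {a b : Q}
    (p : Quiver.Path a b) : linearLift t (of k p) = t ⟨a, b, p⟩ := by
  unfold linearLift of
  erw [Finsupp.linearCombination_single, one_smul]

theorem of_cons {a b c : Q} (p : Quiver.Path a b) (e : b ⟶ c) :
    of k (p.cons e) = of k p * of k e.toPath :=
  (of_mul_of_comp p e.toPath).symm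

variable [Fintype Q]

/-- The universal property of the path algebra: vertices go to complete orthogonal idempotents
`ε a`, arrows from `a` to `b` to elements of `B ε b`. No condition is needed at the source
of an arrow, as `evalPath` starts with `ε a`, so that the image of the arrow
is `ε a * x a b e`. -/
def lift (ε : Q → B) (x : ∀ a b : Q, (a ⟶ b) → B) (hε : CompleteOrthogonalIdempotents ε)
    (hr : ∀ a b e, x a b e * ε b = x a b e) :
    PathAlgebra k Q →ₐ[k] B :=
  AlgHom.ofLinearMap (linearLift fun p => evalPath ε x p.path)
    (by
      rw [one_def, map_sum, ← hε.complete]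
      exact Finset.sum_congr rfl fun a _ => linearLift_of _ _)
    (by
      let L : PathAlgebra k Q →ₗ[k] B := linearLift fun p => evalPath ε x p.path
      have h : (mulMap k).compr₂ L = (LinearMap.mul k B).compl₁₂ L L := by
        refine lhom_ext fun a b p => lhom_ext fun c d q => ?_
        simp only [LinearMap.compr₂_apply, LinearMap.compl₁₂_apply, LinearMap.mul_apply', L,
          ← mul_def, linearLift_of]
        by_cases hbc : b = c
        · subst hbc
          rw [of_mul_of_comp, linearLift_of, evalPath_comp hε.idem hr]
        · rw [of_mul_of_ne _ _ hbc, map_zero, ← evalPath_mul_idem hε.idem hr p,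
            ← idem_mul_evalPath hε.idem q, mul_assoc, ← mul_assoc (ε b), hε.ortho hbc, zero_mul,
            mul_zero]
      exact fun y z => congrArg (fun F => F y z) h)

theorem lift_of (hε : CompleteOrthogonalIdempotents ε)
    (hr : ∀ a b e, x a b e * ε b = x a b e)
    {a b : Q} (p : Quiver.Path a b) :
    lift (k := k) ε x hε hr (of k p) = evalPath ε x p :=
  linearLift_of _ _

theorem algHom_ext' {f g : PathAlgebra k Q →ₐ[k] B}
    (h₀ : ∀ a : Q, f (of k (.nil : Quiver.Path a a)) = g (of k (.nil : Quiver.Path a a)))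
    (h₁ : ∀ (a b : Q) (e : a ⟶ b), f (of k e.toPath) = g (of k e.toPath)) : f = g := by
  refine AlgHom.toLinearMap_injective (lhom_ext fun a b p => ?_)
  change f (of k p) = g (of k p)
  induction p with
  | nil => exact h₀ a
  | cons p e ih => rw [of_cons, map_mul, map_mul, ih, h₁]

variable (k Q) in
theorem completeOrthogonalIdempotents :
    CompleteOrthogonalIdempotents fun a : Q => of k (.nil : Quiver.Path a a) where
  idem a := by rw [IsIdempotentElem, of_mul_of_comp, Quiver.Path.comp_nil]
  ortho a b hab := of_mul_of_ne _ _ hab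
  complete := rfl

end Lift

end PathAlgebra

open PathAlgebra

section Ideal

variable {k : Type w} [Field k] {V : Type u} {Γ : SimpleGraph V}

open Classical in
/-- The coefficient of the loop `(a | b | a)` relative to a generator of the socle at `a`, namely
`(v^a_{r,b})⁻¹` for the reference neighbour `r` of `a`; other paths have coefficient zero. -/
def Coefficients.loopCoeff (v : Coefficients k Γ) :
    ∀ {a c : DoubleGraph Γ}, Quiver.Path a c → k
  | a, c, .cons (b := b) (.cons .nil e) _ =>
    if a = c then (((v.half a ⟨b, e.down⟩)⁻¹ : kˣ) : k) else 0
  | _, _, _ => 0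

theorem Coefficients.loopCoeff_path₂ (v : Coefficients k Γ) {a b : V} (h : Γ.Adj a b) :
    v.loopCoeff (path₂ h h.symm) = (((v.half a ⟨b, h⟩)⁻¹ : kˣ) : k) :=
  if_pos rfl

variable [Fintype V]

/-- A linear map which vanishes on the generators of `I_v` and on all paths of length greater than
two vanishes on `I_v`: multiplying a generator by a path of positive length gives a combination of
paths of length greater than two. -/
theorem Coefficients.eq_zero_of_mem_ideal (v : Coefficients k Γ) {M : Type*} [AddCommGroup M]
    [Module k M] (φ : PathAlgebra k (DoubleGraph Γ) →ₗ[k] M)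
    (h₃ : ∀ (a b : DoubleGraph Γ) (p : Quiver.Path a b), 2 < p.length → φ (of k p) = 0)
    (h₂ : ∀ (a b c : V) (hab : Γ.Adj a b) (hbc : Γ.Adj b c), a ≠ c →
      φ (of k (path₂ hab hbc)) = 0)
    (hl : ∀ (a b c : V) (hab : Γ.Adj a b) (hac : Γ.Adj a c),
      φ (of k (path₂ hab hab.symm)) =
        v.coeff a ⟨b, hab⟩ ⟨c, hac⟩ • φ (of k (path₂ hac hac.symm)))
    {x : PathAlgebra k (DoubleGraph Γ)} (hx : x ∈ v.ideal) : φ x = 0 := by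
  have key : ∀ {a c : DoubleGraph Γ} (s : PathAlgebra k (DoubleGraph Γ)),
      s ∈ Submodule.span k {y | ∃ r : Quiver.Path a c, r.length = 2 ∧ y = of k r} → φ s = 0 →
      ∀ y z, φ (y * s * z) = 0 := by
    intro a c s hs hφ y z
    -- by bilinearity it suffices to multiply by paths
    let L : PathAlgebra k (DoubleGraph Γ) →ₗ[k] PathAlgebra k (DoubleGraph Γ) →ₗ[k] M :=
      ((LinearMap.mul k _).compr₂ φ).comp ((LinearMap.mul k _).flip s)
    suffices h : L = 0 from congrArg (fun F => F y z) h
    refine lhom_ext fun a' b' p => lhom_ext fun c' d' q => ?_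
    change φ (of k p * s * of k q) = 0
    -- if one of the paths has positive length, only paths of length greater than two occur
    have hlong : 0 < p.length + q.length → φ (of k p * s * of k q) = 0 := by
      intro hpq
      clear hφ
      induction hs using Submodule.span_induction with
      | mem y hy =>
        obtain ⟨r, hr, rfl⟩ := hy
        by_cases h1 : b' = a
        · subst h1
          by_cases h2 : c = c'
          · subst h2
            rw [of_mul_of_comp, of_mul_of_comp]
            refine h₃ _ _ _ ?_
            rw [Quiver.Path.length_comp, Quiver.Path.length_comp]
            omega
          · rw [of_mul_of_comp, of_mul_of_ne _ _ h2, map_zero]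
        · rw [of_mul_of_ne _ _ h1, zero_mul, map_zero]
      | zero => rw [mul_zero, zero_mul, map_zero]
      | add y z _ _ hy hz => rw [mul_add, add_mul, map_add, hy, hz, add_zero]
      | smul t y _ hy => rw [mul_smul_comm, smul_mul_assoc, map_smul, hy, smul_zero]
    rcases Nat.eq_zero_or_pos (p.length + q.length) with h0 | h0
    swap
    · exact hlong h0
    cases p with
    | cons => simp at h0
    | nil =>
    cases q with
    | cons => simp at h0
    | nil =>
    -- trivial paths preserve `s` or annihilate it
    have hnil : of k (.nil : Quiver.Path a' a') * s * of k (.nil : Quiver.Path c' c') = s ∨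
        of k (.nil : Quiver.Path a' a') * s * of k (.nil : Quiver.Path c' c') = 0 := by
      have hL : ∀ y ∈ Submodule.span k {y | ∃ r : Quiver.Path a c, r.length = 2 ∧ y = of k r},
          of k (.nil : Quiver.Path a' a') * y * of k (.nil : Quiver.Path c' c') =
            (open Classical in if a' = a ∧ c' = c then (1 : k) else 0) • y := by
        intro y hy
        induction hy using Submodule.span_induction with
        | mem y hy =>
          obtain ⟨r, hr, rfl⟩ := hy
          by_cases h1 : a' = a
          · subst h1
            by_cases h2 : c' = c
            · subst h2
              rw [of_mul_of_comp, of_mul_of_comp, if_pos ⟨rfl, rfl⟩, one_smul,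
                Quiver.Path.nil_comp, Quiver.Path.comp_nil]
            · rw [of_mul_of_comp, of_mul_of_ne _ _ (Ne.symm h2), if_neg (fun h => h2 h.2),
                zero_smul]
          · rw [of_mul_of_ne _ _ h1, zero_mul, if_neg (fun h => h1 h.1), zero_smul]
        | zero => rw [mul_zero, zero_mul, smul_zero]
        | add y z _ _ hy hz => rw [mul_add, add_mul, hy, hz, smul_add]
        | smul t y _ hy => rw [mul_smul_comm, smul_mul_assoc, hy, smul_comm]
      rw [hL s hs]
      split_ifs
      · exact Or.inl (one_smul _ _)
      · exact Or.inr (zero_smul _ _)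
    rcases hnil with h | h
    · rw [h, hφ]
    · rw [h, map_zero]
  rw [Coefficients.ideal, TwoSidedIdeal.mem_span_iff_mem_addSubgroup_closure] at hx
  induction hx using AddSubgroup.closure_induction with
  | mem x hx =>
    obtain ⟨_, ⟨y, -, s, hs, rfl⟩, z, -, rfl⟩ := hx
    rcases hs with ⟨a, b, c, hab, hbc, hac, rfl⟩ | ⟨a, b, c, hab, hac, rfl⟩
    · exact key _ (Submodule.subset_span ⟨_, rfl, rfl⟩) (h₂ a b c hab hbc hac) y z
    · refine key (a := a) (c := a) _ (Submodule.sub_mem _ (Submodule.subset_span ⟨_, rfl, rfl⟩)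
        (Submodule.smul_mem _ _ (Submodule.subset_span ⟨_, rfl, rfl⟩))) ?_ y z
      rw [map_sub, map_smul]
      exact sub_eq_zero.2 (hl a b c hab hac)
  | zero => exact map_zero φ
  | add y z _ _ hy hz => rw [map_add, hy, hz, add_zero]
  | neg y _ hy => rw [map_neg, hy, neg_zero]

/-- Paths of length at most one remain nonzero modulo `I_v`. -/
theorem Coefficients.of_notMem_ideal (v : Coefficients k Γ) {a b : DoubleGraph Γ}
    (p : Quiver.Path a b) (hp : p.length ≤ 1) : of k p ∉ v.ideal := by
  classical
  intro hmem
  have hne : ∀ {c d : DoubleGraph Γ} (q : Quiver.Path c d), 1 < q.length →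
      linearLift (fun q => if q = ⟨a, b, p⟩ then (1 : k) else 0) (of k q) = 0 := by
    intro c d q hq
    rw [linearLift_of, if_neg]
    intro h
    cases h
    omega
  have h := v.eq_zero_of_mem_ideal
    (linearLift fun q : TotalPath (DoubleGraph Γ) => if q = ⟨a, b, p⟩ then (1 : k) else 0)
    (fun _ _ q hq => hne q (by omega)) (fun _ _ _ h h' _ => hne (path₂ h h') Nat.one_lt_two)
    (fun _ _ _ h h' => (hne (path₂ h h.symm) Nat.one_lt_two).trans
      ((congrArg _ (hne (path₂ h' h'.symm) Nat.one_lt_two)).trans (smul_zero _)).symm) hmem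
  rw [linearLift_of, if_pos rfl] at h
  exact one_ne_zero h

/-- The loops `(a | b | a)` remain nonzero modulo `I_v`. -/
theorem Coefficients.loop_notMem_ideal (v : Coefficients k Γ) {a b : V} (h : Γ.Adj a b) :
    of k (path₂ h h.symm) ∉ v.ideal := by
  intro hmem
  have := v.eq_zero_of_mem_ideal (linearLift fun q => v.loopCoeff q.path)
    (fun a b p hp => by
      rw [linearLift_of]
      match p, hp with
      | .cons (.cons (.cons _ _) _) _, _ => rfl)
    (fun a b c hab hbc hac => (linearLift_of _ (path₂ hab hbc)).trans (if_neg hac))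
    (fun a b c hab hac => by
      refine ((linearLift_of _ (path₂ hab hab.symm)).trans ?_).trans
        (congrArg _ (linearLift_of _ (path₂ hac hac.symm))).symm
      refine (v.loopCoeff_path₂ hab).trans
        (Eq.trans ?_ (congrArg (v.coeff a ⟨b, hab⟩ ⟨c, hac⟩ • ·) (v.loopCoeff_path₂ hac).symm))
      change _ = ((v.unit a ⟨b, hab⟩ ⟨c, hac⟩ : kˣ) : k) * _
      rw [← Units.val_mul, unit_eq, div_eq_mul_inv, mul_right_comm, mul_inv_cancel, one_mul])
    hmem
  exact Units.ne_zero _ ((v.loopCoeff_path₂ h).symm.trans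
    ((linearLift_of _ (path₂ h h.symm)).symm.trans this))

end Ideal

/-! ### Presentation of the skew-zigzag algebras and isomorphisms from gauge transformations -/

open PathAlgebra

namespace Coefficients

variable {k : Type w} [Field k] {V : Type u} [Fintype V] {Γ : SimpleGraph V}

/-- The quotient of the path algebra by `I_v`, which is the carrier of `A_v(Γ)` unless `Γ` has one
or two vertices. -/
abbrev Alg (v : Coefficients k Γ) : Type (max u w) := v.ideal.ringCon.Quotient

/-- The projection of the path algebra onto its quotient by `I_v`. -/
abbrev proj (v : Coefficients k Γ) : PathAlgebra k (DoubleGraph Γ) →ₐ[k] v.Alg :=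
  v.ideal.ringCon.mkₐ k

theorem proj_eq_zero_iff (v : Coefficients k Γ) (x : PathAlgebra k (DoubleGraph Γ)) :
    v.proj x = 0 ↔ x ∈ v.ideal :=
  RingCon.eq _

/-- The idempotent of a vertex. -/
def vtx (v : Coefficients k Γ) (a : V) : v.Alg :=
  v.proj (of k (.nil : Quiver.Path (V := DoubleGraph Γ) a a))

/-- The class of an arrow. -/
def arr (v : Coefficients k Γ) {a b : V} (h : Γ.Adj a b) : v.Alg :=
  v.proj (of k (path₁ h))

theorem vtx_idempotents (v : Coefficients k Γ) : CompleteOrthogonalIdempotents v.vtx :=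
  (completeOrthogonalIdempotents k (DoubleGraph Γ)).map v.proj.toRingHom

variable (v : Coefficients k Γ)

theorem vtx_mul_arr {a b : V} (h : Γ.Adj a b) : v.vtx a * v.arr h = v.arr h := by
  rw [vtx, arr, ← map_mul]
  exact congrArg _ ((of_mul_of_comp _ _).trans (congrArg _ (Quiver.Path.nil_comp _)))

theorem arr_mul_vtx {a b : V} (h : Γ.Adj a b) : v.arr h * v.vtx b = v.arr h := by
  rw [vtx, arr, ← map_mul]
  exact congrArg _ ((of_mul_of_comp _ _).trans (congrArg _ (Quiver.Path.comp_nil _)))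

theorem arr_mul_arr {a b c : V} (h : Γ.Adj a b) (h' : Γ.Adj b c) :
    v.arr h * v.arr h' = v.proj (of k (path₂ h h')) := by
  rw [arr, arr, ← map_mul]
  exact congrArg _ (of_mul_of_comp _ _)

theorem arr_mul_arr_of_ne {a b c : V} (h : Γ.Adj a b) (h' : Γ.Adj b c) (hac : a ≠ c) :
    v.arr h * v.arr h' = 0 := by
  rw [arr_mul_arr, proj_eq_zero_iff]
  exact TwoSidedIdeal.subset_span (Or.inl ⟨a, b, c, h, h', hac, rfl⟩)

theorem loop_eq {a b c : V} (h : Γ.Adj a b) (h' : Γ.Adj a c) :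
    v.arr h * v.arr h.symm = v.unit a ⟨b, h⟩ ⟨c, h'⟩ • (v.arr h' * v.arr h'.symm) := by
  rw [← sub_eq_zero, arr_mul_arr, arr_mul_arr]
  refine Eq.trans ?_ ((v.proj_eq_zero_iff _).2
    (TwoSidedIdeal.subset_span (Or.inr ⟨a, b, c, h, h', rfl⟩)))
  rw [map_sub, map_smul]
  rfl

theorem vtx_ne_zero (a : V) : v.vtx a ≠ 0 :=
  fun h => v.of_notMem_ideal (.nil : Quiver.Path (V := DoubleGraph Γ) a a) (Nat.zero_le 1)
    ((v.proj_eq_zero_iff _).1 h)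

theorem arr_ne_zero {a b : V} (h : Γ.Adj a b) : v.arr h ≠ 0 :=
  fun h' => v.of_notMem_ideal (path₁ h) le_rfl ((v.proj_eq_zero_iff _).1 h')

theorem loop_ne_zero {a b : V} (h : Γ.Adj a b) : v.arr h * v.arr h.symm ≠ 0 := by
  rw [arr_mul_arr]
  exact fun h' => v.loop_notMem_ideal h ((v.proj_eq_zero_iff _).1 h')

theorem arr_congr {a b a' b' : V} (h : Γ.Adj a b) (h' : Γ.Adj a' b') (ha : a = a') (hb : b = b') :
    v.arr h = v.arr h' := by
  subst ha
  subst hb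
  rfl

variable {v} in
theorem algHom_ext' {B : Type*} [Ring B] [Algebra k B] {f g : v.Alg →ₐ[k] B}
    (h₀ : ∀ a, f (v.vtx a) = g (v.vtx a))
    (h₁ : ∀ (a b : V) (h : Γ.Adj a b), f (v.arr h) = g (v.arr h)) : f = g := by
  have h : f.comp v.proj = g.comp v.proj :=
    PathAlgebra.algHom_ext' h₀ fun a b e => h₁ a b e.down
  refine AlgHom.ext fun x => ?_
  obtain ⟨x, rfl⟩ := v.ideal.ringCon.mkₐ_surjective (α := k) x
  exact congrArg (fun F => F x) h

/-- The presentation of `A_v` by vertices and arrows. -/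
theorem exists_algHom {B : Type*} [Ring B] [Algebra k B] (ε : V → B)
    (x : ∀ a b : V, Γ.Adj a b → B) (hε : CompleteOrthogonalIdempotents ε)
    (hr : ∀ a b h, x a b h * ε b = x a b h) (hl : ∀ a b h, ε a * x a b h = x a b h)
    (hne : ∀ (a b c : V) (h : Γ.Adj a b) (h' : Γ.Adj b c), a ≠ c → x a b h * x b c h' = 0)
    (hloop : ∀ (a b c : V) (h : Γ.Adj a b) (h' : Γ.Adj a c), x a b h * x b a h.symm =
      v.unit a ⟨b, h⟩ ⟨c, h'⟩ • (x a c h' * x c a h'.symm)) :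
    ∃ f : v.Alg →ₐ[k] B, (∀ a, f (v.vtx a) = ε a) ∧
      ∀ (a b : V) (h : Γ.Adj a b), f (v.arr h) = x a b h := by
  let F : PathAlgebra k (DoubleGraph Γ) →ₐ[k] B :=
    PathAlgebra.lift (Q := DoubleGraph Γ) ε (fun a b e => x a b e.down) hε
      fun a b e => hr a b e.down
  have hF₀ : ∀ a : V, F (of k (.nil : Quiver.Path (V := DoubleGraph Γ) a a)) = ε a :=
    fun a => lift_of (Q := DoubleGraph Γ) hε _ _
  have hF₁ : ∀ (a b : V) (h : Γ.Adj a b), F (of k (path₁ h)) = x a b h := fun a b h =>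
    (lift_of (Q := DoubleGraph Γ) hε _ (path₁ h)).trans (hl a b h)
  have hF₂ : ∀ (a b c : V) (h : Γ.Adj a b) (h' : Γ.Adj b c),
      F (of k (path₂ h h')) = x a b h * x b c h' := fun a b c h h' => by
    rw [← hF₁, ← hF₁, ← map_mul]
    exact congrArg F (of_mul_of_comp _ _).symm
  have hker : v.ideal ≤ TwoSidedIdeal.ker F.toRingHom := by
    rw [Coefficients.ideal, TwoSidedIdeal.span_le]
    rintro y (⟨a, b, c, h, h', hac, rfl⟩ | ⟨a, b, c, h, h', rfl⟩)
    · exact (TwoSidedIdeal.mem_ker _).2 ((hF₂ a b c h h').trans (hne a b c h h' hac))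
    · refine (TwoSidedIdeal.mem_ker _).2 ?_
      change F _ = 0
      rw [map_sub, map_smul]
      refine sub_eq_zero.2 ((hF₂ a b a h h.symm).trans ((hloop a b c h h').trans ?_))
      exact congrArg (fun z => v.coeff a ⟨b, h⟩ ⟨c, h'⟩ • z) (hF₂ a c a h' h'.symm).symm
  exact ⟨v.ideal.ringCon.liftₐ F (TwoSidedIdeal.ringCon_le_iff.1 hker), hF₀, hF₁⟩

/-- The homogeneous components of `A_v`. -/
abbrev algPiece (i : ℕ) : Submodule k v.Alg :=
  (PathAlgebra.piece k (DoubleGraph Γ) i).map v.proj.toLinearMap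

theorem vtx_mem_algPiece (a : V) : v.vtx a ∈ v.algPiece 0 :=
  Submodule.mem_map_of_mem (Submodule.subset_span ⟨_, _, _, rfl, rfl⟩)

theorem arr_mem_algPiece {a b : V} (h : Γ.Adj a b) : v.arr h ∈ v.algPiece 1 :=
  Submodule.mem_map_of_mem (Submodule.subset_span ⟨_, _, path₁ h, rfl, rfl⟩)

theorem algPiece_zero_le : v.algPiece 0 ≤ Submodule.span k (Set.range v.vtx) := by
  rw [Submodule.map_le_iff_le_comap, piece, Submodule.span_le]
  rintro _ ⟨a, b, p, hp, rfl⟩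
  match p, hp with
  | .nil, _ => exact Submodule.subset_span ⟨a, rfl⟩

theorem vtx_mul_mul_vtx_mem (a b : V) {y : v.Alg} (hy : y ∈ v.algPiece 1) :
    v.vtx a * y * v.vtx b ∈ Submodule.span k {z | ∃ h : Γ.Adj a b, z = v.arr h} := by
  have key : ∀ (a' b' : V) (h : Γ.Adj a' b'), v.vtx a * v.arr h * v.vtx b ∈
      Submodule.span k {z | ∃ h : Γ.Adj a b, z = v.arr h} := by
    intro a' b' h
    by_cases ha : a = a'
    · subst ha
      rw [vtx_mul_arr]
      by_cases hb : b' = b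
      · subst hb
        rw [arr_mul_vtx]
        exact Submodule.subset_span ⟨h, rfl⟩
      · rw [← arr_mul_vtx, mul_assoc, v.vtx_idempotents.ortho hb, mul_zero]
        exact Submodule.zero_mem _
    · rw [← vtx_mul_arr, ← mul_assoc, v.vtx_idempotents.ortho ha, zero_mul, zero_mul]
      exact Submodule.zero_mem _
  let L : v.Alg →ₗ[k] v.Alg := LinearMap.mulLeftRight k (v.vtx a, v.vtx b)
  suffices h : v.algPiece 1 ≤
      (Submodule.span k {z | ∃ h : Γ.Adj a b, z = v.arr h}).comap L from h hy
  rw [Submodule.map_le_iff_le_comap, piece, Submodule.span_le]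
  rintro _ ⟨a', b', p, hp, rfl⟩
  obtain ⟨h, rfl⟩ : ∃ h : Γ.Adj a' b', p = path₁ h := by
    match p, hp with
    | .cons .nil e, _ => exact ⟨e.down, rfl⟩
  exact key a' b' h

variable {v}
variable {w : Coefficients k Γ}

/-- A homomorphism that permutes the vertices and rescales the arrows accordingly is graded. -/
theorem map_algPiece_le (f : v.Alg →ₐ[k] w.Alg) (σ : Γ ≃g Γ) (l : V → V → kˣ)
    (h₀ : ∀ a, f (v.vtx a) = w.vtx (σ a))
    (h₁ : ∀ (a b : V) (h : Γ.Adj a b), f (v.arr h) = l a b • w.arr (σ.map_adj_iff.2 h)) (i : ℕ) :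
    (v.algPiece i).map f.toLinearMap ≤ w.algPiece i := by
  have key : ∀ {a b : DoubleGraph Γ} (p : Quiver.Path a b),
      ∃ (c : k) (q : Quiver.Path (V := DoubleGraph Γ) (σ a) (σ b)), q.length = p.length ∧
        f (v.proj (of k p)) = c • w.proj (of k q) := by
    intro a b p
    induction p with
    | nil => exact ⟨1, .nil, rfl, (h₀ a).trans (one_smul _ _).symm⟩
    | @cons b c p e ih =>
      obtain ⟨t, q, hq, h⟩ := ih
      let e' := path₁ (σ.map_adj_iff.2 e.down)
      refine ⟨t * (l b c : kˣ), q.comp e', congrArg (· + 1) hq, ?_⟩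
      have he : f (v.proj (of k e.toPath)) = ((l b c : kˣ) : k) • w.proj (of k e') :=
        h₁ b c e.down
      rw [of_cons, map_mul, map_mul, h, he, smul_mul_smul_comm, ← map_mul]
      exact congrArg (fun y => (t * ((l b c : kˣ) : k)) • w.proj y) (of_mul_of_comp q e')
  rw [Submodule.map_le_iff_le_comap, Submodule.map_le_iff_le_comap, piece, Submodule.span_le]
  rintro _ ⟨a, b, p, hp, rfl⟩
  obtain ⟨c, q, hq, h⟩ := key p
  change f (v.proj (of k p)) ∈ w.algPiece i
  rw [h]
  exact Submodule.smul_mem _ _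
    (Submodule.mem_map_of_mem (Submodule.subset_span ⟨_, _, q, hq.trans hp, rfl⟩))

end Coefficients

open Coefficients

variable {k : Type w} [Field k] {V : Type u} [Fintype V] {Γ : SimpleGraph V}
variable {v w : Coefficients k Γ}

theorem IsGauge.exists_algHom {σ : Γ ≃g Γ} {l : V → V → kˣ}
    (h : IsGauge v w σ fun a b => l a b * l b a) :
    ∃ f : v.Alg →ₐ[k] w.Alg, (∀ a, f (v.vtx a) = w.vtx (σ a)) ∧
      ∀ (a b : V) (h : Γ.Adj a b), f (v.arr h) = l a b • w.arr (σ.map_adj_iff.2 h) := by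
  refine v.exists_algHom (fun a => w.vtx (σ a))
    (fun a b h => l a b • w.arr (σ.map_adj_iff.2 h))
    ((CompleteOrthogonalIdempotents.equiv σ.toEquiv).2 w.vtx_idempotents) ?_ ?_ ?_ ?_
  · intro a b h
    rw [smul_mul_assoc, arr_mul_vtx]
  · intro a b h
    rw [mul_smul_comm, vtx_mul_arr]
  · intro a b c h h' hac
    rw [smul_mul_assoc, mul_smul_comm, arr_mul_arr_of_ne _ _ _ fun e => hac (σ.injective e),
      smul_zero, smul_zero]
  · intro a b c hb hc
    have h' := h.rel a b c hb hc
    have h2 := w.loop_eq (σ.map_adj_iff.2 hb) (σ.map_adj_iff.2 hc)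
    rw [smul_mul_smul_comm, smul_mul_smul_comm, smul_smul, h', h2, smul_smul, mul_comm]

/-- A gauge transformation yields an isomorphism: write `μ(a, b) = λ(a, b) λ(b, a)` and send
`(a | b)` to `λ(a, b) (σ a | σ b)`. -/
theorem IsGauge.iso {σ : Γ ≃g Γ} {μ : V → V → kˣ} (h : IsGauge v w σ μ) :
    (quotientAlg v.ideal).Iso (quotientAlg w.ideal) := by
  classical
  obtain ⟨r, hr⟩ := exists_orientation V
  let l : V → V → kˣ := fun a b => if r a b then μ a b else 1
  have hl : ∀ a b, Γ.Adj a b → l a b * l b a = μ a b := by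
    intro a b hab
    rcases hr a b hab.ne with ⟨h1, h2⟩ | ⟨h1, h2⟩
    · simp only [l, if_pos h1, if_neg h2, mul_one]
    · simp only [l, if_pos h1, if_neg h2, one_mul, h.symm a b hab]
  have hv : IsGauge v w σ fun a b => l a b * l b a :=
    ⟨fun a b _ => mul_comm _ _, fun a b c hb hc => by rw [hl a b hb, hl a c hc, h.rel]⟩
  let l' : V → V → kˣ := fun a b => (l (σ.symm a) (σ.symm b))⁻¹
  have hw : IsGauge w v σ.symm fun a b => l' a b * l' b a := by
    have := hv.inv
    simp only [mul_inv] at this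
    exact this
  obtain ⟨f, hf₀, hf₁⟩ := hv.exists_algHom
  obtain ⟨g, hg₀, hg₁⟩ := hw.exists_algHom
  have hgf : g.comp f = AlgHom.id k _ := by
    refine algHom_ext' (fun a => ?_) fun a b h => ?_
    · rw [AlgHom.comp_apply, hf₀, hg₀, σ.symm_apply_apply, AlgHom.id_apply]
    · rw [AlgHom.comp_apply, hf₁, Units.smul_def, map_smul, hg₁, ← Units.smul_def, smul_smul,
        v.arr_congr _ h (σ.symm_apply_apply a) (σ.symm_apply_apply b)]
      simp only [l', RelIso.symm_apply_apply, mul_inv_cancel, one_smul, AlgHom.id_apply]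
  have hfg : f.comp g = AlgHom.id k _ := by
    refine algHom_ext' (fun a => ?_) fun a b h => ?_
    · rw [AlgHom.comp_apply, hg₀, hf₀, σ.apply_symm_apply, AlgHom.id_apply]
    · rw [AlgHom.comp_apply, hg₁, Units.smul_def, map_smul, hf₁, ← Units.smul_def, smul_smul,
        w.arr_congr _ h (σ.apply_symm_apply a) (σ.apply_symm_apply b)]
      simp only [l', inv_mul_cancel, one_smul, AlgHom.id_apply]
  refine ⟨AlgEquiv.ofAlgHom f g hfg hgf, fun i => le_antisymm ?_ fun y hy => ?_⟩
  · exact map_algPiece_le f σ l hf₀ hf₁ i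
  · exact ⟨g y, map_algPiece_le g σ.symm l' hg₀ hg₁ i ⟨y, hy, rfl⟩,
      congrArg (fun F => F y) hfg⟩

/-! ### Gauge transformations from graded isomorphisms, and the bijection -/

open PathAlgebra Coefficients

/-- Two complete orthogonal families of nonzero idempotents with the same index set, one of them in
the span of the other, agree up to a permutation: the coefficients are `0` or `1`, and each
`ε b` occurs in exactly one of the sums. -/
theorem exists_equiv_of_mem_span {k R V : Type*} [Field k] [Ring R] [Algebra k R] [Fintype V]
    {ε f : V → R} (hε : CompleteOrthogonalIdempotents ε) (hf : CompleteOrthogonalIdempotents f)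
    (hε₀ : ∀ a, ε a ≠ 0) (hf₀ : ∀ a, f a ≠ 0) (hs : ∀ a, f a ∈ Submodule.span k (Set.range ε)) :
    ∃ σ : V ≃ V, ∀ a, f a = ε (σ a) := by
  classical
  have hc : ∀ a, ∃ c : V → k, ∑ b, c b • ε b = f a := fun a =>
    (Submodule.mem_span_range_iff_exists_fun k).1 (hs a)
  choose c hc using hc
  have hmul : ∀ a b, f a * ε b = c a b • ε b := by
    intro a b
    rw [← hc, Finset.sum_mul, Finset.sum_eq_single b]
    · rw [smul_mul_assoc, hε.idem b]
    · intro b' _ hb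
      rw [smul_mul_assoc, hε.ortho hb, smul_zero]
    · exact fun h => absurd (Finset.mem_univ b) h
  have hinj : ∀ {b : V} {s t : k}, s • ε b = t • ε b → s = t := fun {b s t} h =>
    smul_left_injective k (hε₀ b) h
  have hmul₂ : ∀ a a' b, f a * f a' * ε b = (c a b * c a' b) • ε b := fun a a' b => by
    rw [mul_assoc, hmul, mul_smul_comm, hmul, smul_smul, mul_comm]
  have hidem : ∀ a b, c a b * c a b = c a b := fun a b => hinj (b := b) <| by
    rw [← hmul₂, hf.idem a, hmul]
  have hortho : ∀ a a' b, a ≠ a' → c a b * c a' b = 0 := fun a a' b h => hinj (b := b) <| by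
    rw [← hmul₂, hf.ortho h, zero_mul, zero_smul]
  have hex : ∀ b, ∃ a, c a b ≠ 0 := by
    intro b
    by_contra! h
    refine hε₀ b ?_
    rw [← one_mul (ε b), ← hf.complete, Finset.sum_mul]
    exact Finset.sum_eq_zero fun a _ => by rw [hmul, h, zero_smul]
  choose τ hτ using hex
  have huniq : ∀ a b, c a b ≠ 0 → a = τ b := by
    intro a b h
    by_contra hne
    exact (mul_ne_zero h (hτ b)) (hortho _ _ _ hne)
  have hsurj : Function.Surjective τ := by
    intro a
    by_contra! h
    refine hf₀ a ?_
    rw [← hc]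
    refine Finset.sum_eq_zero fun b _ => ?_
    have : c a b = 0 := by
      by_contra h'
      exact h b (huniq a b h').symm
    rw [this, zero_smul]
  let T : V ≃ V := Equiv.ofBijective τ (Finite.surjective_iff_bijective.1 hsurj)
  refine ⟨T.symm, fun a => ?_⟩
  rw [← hc, Finset.sum_eq_single (T.symm a)]
  · have h1 : c a (T.symm a) ≠ 0 := by
      have := hτ (T.symm a)
      rwa [show τ (T.symm a) = a from T.apply_symm_apply a] at this
    rw [mul_right_cancel₀ h1 ((hidem _ _).trans (one_mul _).symm), one_smul]
  · intro b _ hb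
    have : c a b = 0 := by
      by_contra h'
      exact hb (T.eq_symm_apply.2 (huniq a b h').symm)
    rw [this, zero_smul]
  · exact fun h => absurd (Finset.mem_univ _) h

section

variable {k : Type w} [Field k] {V : Type u} [Fintype V] {Γ : SimpleGraph V}
variable {v w : Coefficients k Γ}

/-- The image of the arrow `(a | b)` is a nonzero element of degree one between the idempotents of
`σ a` and `σ b`, which leaves only the multiples of the arrow `(σ a | σ b)`. -/
theorem exists_smul_arr {e : v.Alg →ₐ[k] w.Alg} (he : Function.Injective e)
    (hpiece : ∀ y ∈ v.algPiece 1, e y ∈ w.algPiece 1) {σ : V → V}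
    (hσ : ∀ a, e (v.vtx a) = w.vtx (σ a)) {a b : V} (h : Γ.Adj a b) :
    ∃ (h' : Γ.Adj (σ a) (σ b)) (c : kˣ), e (v.arr h) = c • w.arr h' := by
  have hne : e (v.arr h) ≠ 0 := fun h0 => v.arr_ne_zero h (he (h0.trans (map_zero e).symm))
  have hmem := w.vtx_mul_mul_vtx_mem (σ a) (σ b) (hpiece _ (v.arr_mem_algPiece h))
  rw [← hσ, ← hσ, ← map_mul, ← map_mul, vtx_mul_arr, arr_mul_vtx] at hmem
  by_cases h' : Γ.Adj (σ a) (σ b)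
  · have hset : {z | ∃ h : Γ.Adj (σ a) (σ b), z = w.arr h} = {w.arr h'} :=
      Set.ext fun z => ⟨fun ⟨_, hz⟩ => hz, fun hz => ⟨h', hz⟩⟩
    rw [hset, Submodule.mem_span_singleton] at hmem
    obtain ⟨c, hc⟩ := hmem
    have hc0 : c ≠ 0 := by
      rintro rfl
      exact hne (hc.symm.trans (zero_smul _ _))
    exact ⟨h', Units.mk0 c hc0, hc.symm⟩
  · have hset : {z | ∃ h : Γ.Adj (σ a) (σ b), z = w.arr h} = ∅ :=
      Set.eq_empty_of_forall_notMem fun z ⟨h, _⟩ => h' h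
    rw [hset, Submodule.span_empty, Submodule.mem_bot] at hmem
    exact absurd hmem hne

/-- A graded isomorphism permutes the vertex idempotents, which span the component of degree zero,
and rescales the arrows; comparing loops yields a gauge transformation. -/
theorem exists_isGauge_of_iso (h : (quotientAlg v.ideal).Iso (quotientAlg w.ideal)) :
    ∃ (σ : Γ ≃g Γ) (μ : V → V → kˣ), IsGauge v w σ μ := by
  classical
  obtain ⟨e, he⟩ := h
  change v.Alg ≃ₐ[k] w.Alg at e
  have he' : ∀ i, ∀ y ∈ v.algPiece i, e y ∈ w.algPiece i := fun i y hy => by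
    have := Submodule.mem_map_of_mem (f := e.toLinearMap) hy
    exact (he i).le this
  have he'' : ∀ i, ∀ y ∈ w.algPiece i, e.symm y ∈ v.algPiece i := fun i y hy => by
    obtain ⟨x, hx, rfl⟩ := (he i).ge hy
    exact (congrArg (· ∈ v.algPiece i) (e.symm_apply_apply x)).mpr hx
  obtain ⟨σ, hσ⟩ := exists_equiv_of_mem_span (k := k) w.vtx_idempotents
    (v.vtx_idempotents.map e.toRingEquiv.toRingHom) w.vtx_ne_zero
    (fun a => (map_ne_zero_iff e e.injective).2 (v.vtx_ne_zero a))
    (fun a => w.algPiece_zero_le (he' 0 _ (v.vtx_mem_algPiece a)))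
  have hσ₁ : ∀ a, e (v.vtx a) = w.vtx (σ a) := hσ
  have hσ₂ : ∀ a, e.symm (w.vtx a) = v.vtx (σ.symm a) := fun a => by
    rw [AlgEquiv.symm_apply_eq, hσ₁, σ.apply_symm_apply]
  have hadj : ∀ {a b : V} (h : Γ.Adj a b), ∃ (h' : Γ.Adj (σ a) (σ b)) (c : kˣ),
      e (v.arr h) = c • w.arr h' := fun h =>
    exists_smul_arr (e := e.toAlgHom) e.injective (he' 1) hσ₁ h
  let s : Γ ≃g Γ :=
    { σ with
      map_rel_iff' := fun {a b} => by
        refine ⟨fun h => ?_, fun h => (hadj h).1⟩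
        obtain ⟨h', -⟩ := exists_smul_arr (e := e.symm.toAlgHom) e.symm.injective (he'' 1) hσ₂ h
        simpa using h' }
  -- the scalars as a total function of two vertices
  have hl : ∀ a b, ∃ c : kˣ, ∀ h : Γ.Adj a b, e (v.arr h) = c • w.arr (s.map_adj_iff.2 h) := by
    intro a b
    by_cases h : Γ.Adj a b
    · obtain ⟨h', c, hc⟩ := hadj h
      exact ⟨c, fun _ => hc⟩
    · exact ⟨1, fun h' => absurd h' h⟩
  choose l hl using hl
  refine ⟨s, fun a b => l a b * l b a, fun a b _ => mul_comm _ _, fun a b c hb hc => ?_⟩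
  have h1 := congrArg e (v.loop_eq hb hc)
  rw [Units.smul_def, map_smul, map_mul, map_mul, hl, hl, hl, hl, smul_mul_smul_comm,
    smul_mul_smul_comm, w.loop_eq (s.map_adj_iff.2 hb) (s.map_adj_iff.2 hc), ← Units.smul_def,
    smul_smul, smul_smul] at h1
  have h2 : ∀ s t : kˣ, ∀ y : w.Alg, y ≠ 0 → s • y = t • y → s = t := fun s t y hy h =>
    Units.ext (smul_left_injective k hy h)
  rw [mul_comm (w.unit _ _ _)]
  exact (h2 _ _ _ (w.loop_ne_zero _) h1).symm

theorem iso_quotientAlg_iff :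
    (quotientAlg v.ideal).Iso (quotientAlg w.ideal) ↔
      ∃ σ : Γ ≃g Γ, v.cohomologyClass = σ • w.cohomologyClass := by
  constructor
  · intro h
    obtain ⟨σ, h⟩ := exists_isGauge_of_iso h
    exact ⟨σ⁻¹, (v.exists_isGauge_iff w σ).1 h⟩
  · rintro ⟨σ, h⟩
    obtain ⟨μ, hμ⟩ := (v.exists_isGauge_iff w σ⁻¹).2 (by rwa [inv_inv])
    exact hμ.iso

/-- With at most two vertices every vertex has at most one neighbour, and all coefficients are
equal to `1`. -/
theorem Coefficients.eq_of_card_le_two (h : Fintype.card V ≤ 2) (v w : Coefficients k Γ) :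
    v = w := by
  have hs : ∀ a : V, Subsingleton (Γ.neighborSet a) := by
    classical
    refine fun a => ⟨fun b c => Subtype.ext ?_⟩
    by_contra hbc
    have := Fintype.two_lt_card_iff.2 ⟨a, b.1, c.1, Γ.ne_of_adj b.2, Γ.ne_of_adj c.2, hbc⟩
    omega
  have hone : ∀ (v : Coefficients k Γ) a b c, v.coeff a b c = 1 := fun v a b c => by
    rw [Subsingleton.elim b c, v.coeff_self]
  obtain ⟨cv, _, _, _⟩ := v
  obtain ⟨cw, _, _, _⟩ := w
  obtain rfl : cv = cw := by
    funext a b c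
    exact (hone ⟨cv, ‹_›, ‹_›, ‹_›⟩ a b c).trans (hone ⟨cw, ‹_›, ‹_›, ‹_›⟩ a b c).symm
  rfl

theorem Coefficients.isoClass_eq_iff :
    v.isoClass = w.isoClass ↔ ∃ σ : Γ ≃g Γ, v.cohomologyClass = σ • w.cohomologyClass := by
  have hiso : v.isoClass = w.isoClass ↔ v.algebra.Iso w.algebra := Quotient.eq
  rw [hiso]
  by_cases h : Fintype.card V ≤ 2
  · obtain rfl := eq_of_card_le_two h v w
    exact ⟨fun _ => ⟨1, (one_smul _ _).symm⟩, fun _ => .refl _⟩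
  · rw [Coefficients.algebra, Coefficients.algebra, if_neg (by omega), if_neg (by omega),
      if_neg (by omega), if_neg (by omega)]
    exact iso_quotientAlg_iff

theorem Coefficients.isoClass_surjective :
    Function.Surjective (isoClass : Coefficients k Γ → Moduli k Γ) := by
  intro y
  induction y using Quotient.inductionOn with
  | h A =>
    obtain ⟨_, v, rfl⟩ := A
    exact ⟨v, rfl⟩

end

/-- Two surjections with the same fibres have isomorphic targets. -/
theorem exists_equiv_of_surjective {X Y Z : Type*} {f : X → Y} {g : X → Z}
    (hf : Function.Surjective f) (hg : Function.Surjective g)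
    (h : ∀ x y, f x = f y ↔ g x = g y) : ∃ Φ : Y ≃ Z, ∀ x, Φ (f x) = g x := by
  have hΦ : ∀ x, g (Function.surjInv hf (f x)) = g x := fun x =>
    (h _ _).1 (Function.surjInv_eq hf (f x))
  refine ⟨Equiv.ofBijective (fun y => g (Function.surjInv hf y)) ⟨fun y y' hy => ?_, fun z => ?_⟩,
    hΦ⟩
  · have := (h _ _).2 hy
    rwa [Function.surjInv_eq hf, Function.surjInv_eq hf] at this
  · obtain ⟨x, rfl⟩ := hg z
    exact ⟨f x, hΦ x⟩

end SkewZigzag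

end

theorem theorem2 {k : Type*} [Field k] (hk : ∀ x : k, IsSquare x)
    {V : Type*} [Fintype V] (Γ : SimpleGraph V) :
    ∃ Φ : SkewZigzag.Moduli k Γ ≃ SkewZigzag.H1Orbits Γ k,
      ∀ v : SkewZigzag.Coefficients k Γ,
        Φ v.isoClass =
          Quotient.mk (MulAction.orbitRel (Γ ≃g Γ) (SkewZigzag.H1 Γ k)) v.cohomologyClass := by
  refine SkewZigzag.exists_equiv_of_surjective SkewZigzag.Coefficients.isoClass_surjective
    (Quotient.mk_surjective.comp SkewZigzag.Coefficients.cohomologyClass_surjective) fun v w => ?_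
  rw [SkewZigzag.Coefficients.isoClass_eq_iff, Quotient.eq, MulAction.orbitRel_apply,
    MulAction.mem_orbit_iff]
  exact exists_congr fun σ => eq_comm
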